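/- Let $g:\mathbb R\to[0,\infty)$ be even and continuous and let $\alpha\ge 0$. *Continuum Ising model.* Let $\mathbb P$ be the law of the continuous-time random walk $X=(X_t)_{t\ge0}$ on $\{-1,1\}$ with $\mathbb P(X_0=1)=\mathbb P(X_0=-1)=\tfrac12$ which changes sign after i.i.d. $\operatorname{Exp}(1)$ waiting times that are independent of $X_0$. For $T>0$ let $$\mathbb P_{\alpha,T}(\mathrm dX)=\frac1{Z_{\alpha,T}}\exp\Big(\alpha\iint_{[0,T]^2}g(t-s)X_sX_t\,\mathrm ds\,\mathrm dt\Big)\mathbb P(\mathrm dX),$$ where $Z_{\alpha,T}$ is the normalizing constant, and for $0\le t\le T$ let $\tau_{\alpha,1,T}(t)=\mathbb E_{\alpha,T}[X_t\mid X_0=1]$ and $\tau_{\alpha,1}(t)=\lim_{T\to\infty}\tau_{\alpha,1,T}(t)$. *Continuum percolation.* Let $\xi_1$ be a Poisson point process on $[0,\infty)$ with intensity measure $2\,\mathrm dx$, with points $x_1<x_2<\dots$, and set $x_0=0$. Independently of $\xi_1$, let $\xi_2$ be a Poisson point process on $[0,\infty)^2$ with intensity measure $2\alpha g(t-s)\mathbf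 1_{\{s<t\}}\,\mathrm ds\,\mathrm dt$; its points are called bonds. For $k<m$, connect the intervals $[x_k,x_{k+1})$ and $[x_m,x_{m+1})$ if and only if there is a bond $(s,t)$ with $s\in[x_k,x_{k+1})$ and $t\in[x_m,x_{m+1})$. Write $x\leftrightarrow y$ if the intervals containing $x$ and $y$ lie in the same connected component of the resulting graph, and let $\mathbf P_{\alpha,\mathsf c}$ denote the law of this percolation. Then for every $n\in\mathbb N=\{0,1,2,\dots\}$ the limit defining $\tau_{\alpha,1}(n)$ exists, and $$\tau_{\alpha,1}(n)\ \ge\ \mathbf P_{\alpha,\mathsf c}(0\leftrightarrow n).$$ -/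

import Mathlib

open MeasureTheory ProbabilityTheory Filter Topology
open scoped ENNReal

noncomputable section

namespace ContinuumIsing

/-! ### The continuum Ising model -/

/-- Sample space of the continuous time random walk on `{-1, 1}`:
a starting spin together with the sequence of waiting times. -/
abbrev PathSpace : Type := ℝ × (ℕ → ℝ)

/-- Uniform starting spin on `{-1, 1}`, and independently of it i.i.d. `Exp(1)` waiting times. -/
def walkLaw : Measure PathSpace :=
  ((2⁻¹ : ℝ≥0∞) • Measure.dirac (1 : ℝ) + (2⁻¹ : ℝ≥0∞) • Measure.dirac (-1 : ℝ)).prod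
    (Measure.infinitePi fun _ : ℕ => expMeasure 1)

/-- Number of jumps up to time `t`; the `k`-th jump (counted from `0`) happens at the sum of the
first `k + 1` waiting times. -/
def numJumps (ω : PathSpace) (t : ℝ) : ℕ :=
  {k : ℕ | ∑ i ∈ Finset.range (k + 1), ω.2 i ≤ t}.ncard

/-- The spin `X_t`: it starts at `ω.1` and changes sign at every jump. -/
def spin (t : ℝ) (ω : PathSpace) : ℝ := ω.1 * (-1) ^ numJumps ω t

/-- The path measure with pair potential `g`, coupling `α`, on the time horizon `[0, T]`:
density `Z⁻¹ exp (α ∬_{[0,T]²} g(t - s) X_s X_t ds dt)` with respect to the law of the walk. -/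
def isingMeasure (g : ℝ → ℝ) (α T : ℝ) : Measure PathSpace :=
  walkLaw.tilted fun ω =>
    α * ∫ p in Set.Icc (0 : ℝ) T ×ˢ Set.Icc (0 : ℝ) T, g (p.2 - p.1) * (spin p.1 ω * spin p.2 ω)

/-- Finite volume two-point function: the expectation of `X_t` given `X_0 = 1`. -/
def twoPointT (g : ℝ → ℝ) (α T t : ℝ) : ℝ :=
  ∫ ω, spin t ω ∂((isingMeasure g α T)[|{ω | spin 0 ω = 1}])

/-- Two-point function in the limit `T → ∞`. -/
def twoPoint (g : ℝ → ℝ) (α t : ℝ) : ℝ :=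
  limUnder atTop fun T : ℝ => twoPointT g α T t

/-! ### Poisson processes -/

/-- Number of points of a configuration in the set `B`. -/
def countIn {Ω E : Type*} (ξ : Ω → Set E) (B : Set E) (ω : Ω) : ℕ∞ := (ξ ω ∩ B).encard

/-- The random countable set `ξ` is a Poisson process with (diffuse) intensity measure `μ`. -/
structure IsPoissonProcess {Ω E : Type*} [MeasurableSpace Ω] [MeasurableSpace E]
    (ξ : Ω → Set E) (μ : Measure E) (P : Measure Ω) : Prop where
  countable : ∀ ω, (ξ ω).Countable
  measurable_count : ∀ B, MeasurableSet B → Measurable (countIn ξ B)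
  /-- The number of points in a set of finite intensity is Poisson distributed. -/
  count_law : ∀ B, MeasurableSet B → μ B ≠ ∞ → ∀ k : ℕ,
    P {ω | countIn ξ B ω = k} = poissonMeasure (μ B).toNNReal {k}
  /-- There are infinitely many points in a set of infinite intensity. -/
  count_top : ∀ B, MeasurableSet B → μ B = ∞ → ∀ᵐ ω ∂P, countIn ξ B ω = ⊤
  /-- The numbers of points in pairwise disjoint sets are independent. -/
  indep_count : ∀ (k : ℕ) (B : Fin k → Set E), (∀ i, MeasurableSet (B i)) →
    Pairwise (fun i j => Disjoint (B i) (B j)) → iIndepFun (fun i => countIn ξ (B i)) P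

/-- The σ-algebra generated by the random point configuration `ξ`. -/
abbrev configSigma {Ω E : Type*} [MeasurableSpace E] (ξ : Ω → Set E) : MeasurableSpace Ω :=
  ⨆ (B : Set E) (_ : MeasurableSet B), MeasurableSpace.comap (countIn ξ B) ⊤

/-- Intensity `2 dx` on `[0, ∞)` of the cut points. -/
def cutIntensity : Measure ℝ := (2 : ℝ≥0∞) • volume.restrict (Set.Ici 0)

/-- Intensity `2 α g(t - s) 1_{s < t} ds dt` on `[0, ∞)²` of the bonds. -/
def bondIntensity (g : ℝ → ℝ) (α : ℝ) : Measure (ℝ × ℝ) :=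
  (volume.restrict {p : ℝ × ℝ | 0 ≤ p.1 ∧ p.1 < p.2}).withDensity
    fun p => ENNReal.ofReal (2 * α * g (p.2 - p.1))

/-! ### Percolation -/

/-- The interval containing `x` of the partition of `[0, ∞)` at the points of `S` into intervals
`[x_k, x_{k+1})`: two points are in the same interval iff no `c ∈ S` satisfies `a < c ≤ b`, where
`a` is the smaller and `b` the larger one of them. -/
def cell (S : Set ℝ) (x : ℝ) : Set ℝ := {y | 0 ≤ y ∧ Disjoint S (Set.uIoc x y)}

/-- The graph whose vertices of interest are the intervals cut out by `S` (other sets are isolated);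
two distinct intervals are adjacent iff some bond in `B` has one endpoint in each of them. -/
def cellGraph (S : Set ℝ) (B : Set (ℝ × ℝ)) : SimpleGraph (Set ℝ) where
  Adj I J := I ≠ J ∧ (∃ x, 0 ≤ x ∧ I = cell S x) ∧ (∃ y, 0 ≤ y ∧ J = cell S y) ∧
    ∃ p ∈ B, (p.1 ∈ I ∧ p.2 ∈ J) ∨ (p.1 ∈ J ∧ p.2 ∈ I)
  symm := ⟨by
    rintro I J ⟨h, hI, hJ, p, hp, hh⟩
    exact ⟨h.symm, hJ, hI, p, hp, hh.symm⟩⟩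
  loopless := ⟨fun _ h => h.1 rfl⟩

/-- `x ↔ y`: the intervals containing `x` and `y` lie in the same connected component. -/
def Connected (S : Set ℝ) (B : Set (ℝ × ℝ)) (x y : ℝ) : Prop :=
  (cellGraph S B).Reachable (cell S x) (cell S y)

end ContinuumIsing

end

/-! The proof is a Fortuin–Kasteleyn comparison on a grid, followed by a passage to the continuum.

Sampled with mesh h = 1/m, the walk with X_0 = 1 is a nearest-neighbour Ising chain with flip
probability (1 - e^{-2h})/2 (`waitLaw_grid`). The interaction energy is the integral of X_s X_t
against the bond intensity itself (`integral_boxIntensity`). Rounding times up to grid points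
therefore turns it into pair couplings J, where J is the intensity of bonds between two grid cells.
The two-point function becomes a correlation in a finite Ising model whose edge weights a are
2e^{-2h}/(1 - e^{-2h}) on neighbours and e^{2J} - 1 on long edges.

Expanding over edge sets, this correlation is a connection probability in the random cluster model
with cluster factor 2. The percolation on the same grid is a product measure with p = e^{-2h} (no
cut) and p = 1 - e^{-J} (some bond). Since an extra edge lowers the cluster factor at most by 2,
Holley's inequality gives domination as soon as 2p ≤ a(1 - p). This is an equality for neighbours
and amounts to (e^J - 1)² ≥ 0 for long edges (`percolation_le_ising_correlation`,
`gridOpenProb_le`). Holley's inequality between two random cluster weights yields monotonicity in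
the couplings, hence in T, and so the existence of the limit (`twoPointT_mono`).

As m → ∞ the grid correlations converge because paths are right-continuous (`tendsto_gridCorr`). A
continuum connection uses finitely many bonds and intervals, so it is visible on all fine grids
(`Connected.gridLinked`), and a Fatou bound transfers the inequality. -/

noncomputable section

namespace ContinuumIsing

/-! ### Ising spins and percolation on a finite multigraph -/

section Discrete

set_option linter.unusedSectionVars false

variable {V E : Type*} [Fintype V] [DecidableEq V] [Fintype E] [DecidableEq E]

/-- The spin configuration `σ` is constant along every edge of `O`. -/
def Compatible (ends : E → V × V) (O : Finset E) (σ : V → ℤˣ) : Prop :=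
  ∀ e ∈ O, σ (ends e).1 = σ (ends e).2

instance (ends : E → V × V) (O : Finset E) : DecidablePred (Compatible ends O) := fun σ =>
  inferInstanceAs (Decidable (∀ e ∈ O, σ (ends e).1 = σ (ends e).2))

/-- `x` and `y` are connected by edges of `O`, expressed through spin configurations. -/
def Linked (ends : E → V × V) (O : Finset E) (x y : V) : Prop :=
  ∀ σ, Compatible ends O σ → σ x = σ y

instance (ends : E → V × V) (O : Finset E) (x y : V) : Decidable (Linked ends O x y) :=
  inferInstanceAs (Decidable (∀ σ, Compatible ends O σ → σ x = σ y))

/-- The product of the spins at `x` and `y`, as a real number. -/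
def spinProd (σ : V → ℤˣ) (x y : V) : ℝ := ((σ x * σ y : ℤˣ) : ℤ)

lemma spinProd_eq_ite (σ : V → ℤˣ) (x y : V) :
    spinProd σ x y = if σ x = σ y then 1 else -1 := by
  unfold spinProd
  rcases Int.units_eq_one_or (σ x) with h | h <;> rcases Int.units_eq_one_or (σ y) with h' | h' <;>
    simp [h, h']

lemma spinProd_mul (σ τ : V → ℤˣ) (x y : V) :
    spinProd (τ * σ) x y = spinProd τ x y * spinProd σ x y := by
  simp only [spinProd, Pi.mul_apply]
  push_cast
  ring

lemma Compatible.mul {ends : E → V × V} {O : Finset E} {σ τ : V → ℤˣ}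
    (hτ : Compatible ends O τ) : Compatible ends O (τ * σ) ↔ Compatible ends O σ := by
  refine forall₂_congr fun e he => ?_
  simp [hτ e he]

lemma Compatible.mono {ends : E → V × V} {O O' : Finset E} (h : O ⊆ O') {σ : V → ℤˣ}
    (hσ : Compatible ends O' σ) : Compatible ends O σ := fun e he => hσ e (h he)

lemma Linked.mono {ends : E → V × V} {O O' : Finset E} (h : O ⊆ O') {x y : V}
    (hl : Linked ends O x y) : Linked ends O' x y := fun _ hσ => hl _ (hσ.mono h)

/-- The number of spin configurations compatible with `O`. -/
def numCompatible (ends : E → V × V) (O : Finset E) : ℝ :=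
  ∑ σ, if Compatible ends O σ then 1 else 0

lemma numCompatible_pos (ends : E → V × V) (O : Finset E) : 0 < numCompatible ends O := by
  refine Finset.sum_pos' (fun σ _ => by split_ifs <;> norm_num) ⟨1, Finset.mem_univ _, ?_⟩
  have h : Compatible ends O 1 := fun e _ => rfl
  rw [if_pos h]
  norm_num

/-- If `x` and `y` are not linked, some compatible `τ` separates them. Pointwise multiplication by
`τ` permutes the compatible configurations and reverses the sign of the product of the two spins, so
the sum cancels. -/
lemma sum_compatible_spinProd (ends : E → V × V) (O : Finset E) (x y : V) :
    (∑ σ, if Compatible ends O σ then spinProd σ x y else 0)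
      = if Linked ends O x y then numCompatible ends O else 0 := by
  split_ifs with h
  · refine Finset.sum_congr rfl fun σ _ => ?_
    split_ifs with hσ
    · rw [spinProd_eq_ite, if_pos (h σ hσ)]
    · rfl
  · simp only [Linked, not_forall] at h
    obtain ⟨τ, hτ, hxy⟩ := h
    have h1 : (∑ σ, if Compatible ends O σ then spinProd σ x y else 0)
        = ∑ σ, -(if Compatible ends O σ then spinProd σ x y else 0) := by
      rw [← Equiv.sum_comp (Equiv.mulLeft τ)]
      refine Finset.sum_congr rfl fun σ _ => ?_
      simp only [Equiv.coe_mulLeft, hτ.mul, spinProd_mul, spinProd_eq_ite τ, if_neg hxy]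
      split_ifs <;> ring
    rw [Finset.sum_neg_distrib] at h1
    linarith

/-- The indicator of equal spins at the ends of `e` is half of one plus their product. Thus a new
edge keeps the count if its ends are already linked and halves it otherwise. -/
lemma two_mul_numCompatible_insert (ends : E → V × V) (O : Finset E) (e : E) :
    2 * numCompatible ends (insert e O) = numCompatible ends O *
      (1 + if Linked ends O (ends e).1 (ends e).2 then 1 else 0) := by
  have h := sum_compatible_spinProd ends O (ends e).1 (ends e).2
  have h2 : 2 * numCompatible ends (insert e O) = numCompatible ends O +
      ∑ σ, if Compatible ends O σ then spinProd σ (ends e).1 (ends e).2 else 0 := by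
    rw [numCompatible, numCompatible, ← Finset.sum_add_distrib, Finset.mul_sum]
    refine Finset.sum_congr rfl fun σ _ => ?_
    have h3 : Compatible ends (insert e O) σ ↔
        σ (ends e).1 = σ (ends e).2 ∧ Compatible ends O σ := by
      simp [Compatible]
    simp only [h3, spinProd_eq_ite]
    split_ifs <;> simp_all; norm_num
  rw [h2, h]
  split_ifs <;> ring

/-- Log-supermodularity of the cluster factor: the ratio gained from adding `e` is 1 or 1/2, and it
can only increase with the edge set because linkedness does. -/
lemma numCompatible_insert_mul_le (ends : E → V × V) {O O' : Finset E} (h : O ⊆ O') (e : E) :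
    numCompatible ends (insert e O) * numCompatible ends O'
      ≤ numCompatible ends O * numCompatible ends (insert e O') := by
  have h1 := two_mul_numCompatible_insert ends O e
  have h2 := two_mul_numCompatible_insert ends O' e
  have hp := mul_pos (numCompatible_pos ends O) (numCompatible_pos ends O')
  have h3 : numCompatible ends (insert e O) = numCompatible ends O *
      (1 + if Linked ends O (ends e).1 (ends e).2 then 1 else 0) / 2 := by linarith
  have h4 : numCompatible ends (insert e O') = numCompatible ends O' *
      (1 + if Linked ends O' (ends e).1 (ends e).2 then 1 else 0) / 2 := by linarith
  rw [h3, h4]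
  by_cases hl : Linked ends O (ends e).1 (ends e).2
  · rw [if_pos hl, if_pos (hl.mono h)]
    linarith
  · rw [if_neg hl]
    split_ifs <;> linarith

lemma numCompatible_union_mul_le (ends : E → V × V) {O O' : Finset E} (h : O ⊆ O')
    (D : Finset E) :
    numCompatible ends (O ∪ D) * numCompatible ends O'
      ≤ numCompatible ends O * numCompatible ends (O' ∪ D) := by
  induction D using Finset.induction_on with
  | empty => simp
  | insert e D _ ih =>
    have h1 := numCompatible_insert_mul_le ends (Finset.union_subset_union_left (t := D) h) e
    rw [Finset.union_insert, Finset.union_insert]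
    have hp := numCompatible_pos ends (O ∪ D)
    -- The one-edge inequality is multiplied by the induction hypothesis, and the intermediate
    -- counts cancel.
    refine le_of_mul_le_mul_right ?_ (mul_pos hp (numCompatible_pos ends (O' ∪ D)))
    have := mul_le_mul h1 ih (mul_pos hp (numCompatible_pos ends O')).le
      (mul_pos hp (numCompatible_pos ends (insert e (O' ∪ D)))).le
    nlinarith

lemma numCompatible_le_two_pow_mul (ends : E → V × V) (O D : Finset E) :
    numCompatible ends O ≤ 2 ^ D.card * numCompatible ends (O ∪ D) := by
  induction D using Finset.induction_on with
  | empty => simp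
  | insert e D he ih =>
    rw [Finset.union_insert, Finset.card_insert_of_notMem he, pow_succ, mul_assoc,
      two_mul_numCompatible_insert]
    refine ih.trans (mul_le_mul_of_nonneg_left ?_ (by positivity))
    have := numCompatible_pos ends (O ∪ D)
    split_ifs <;> nlinarith

/-! ### Random cluster expansion and stochastic domination. -/

/-- The random cluster weight with edge weights `a`. -/
def clusterWeight (ends : E → V × V) (a : E → ℝ) (O : Finset E) : ℝ :=
  (∏ e ∈ O, a e) * numCompatible ends O

/-- The Ising weight with edge weights `a`. -/
def isingWeight (ends : E → V × V) (a : E → ℝ) (σ : V → ℤˣ) : ℝ :=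
  ∏ e, (1 + if σ (ends e).1 = σ (ends e).2 then a e else 0)

/-- The Bernoulli percolation weight with edge probabilities `p`. -/
def bernoulliWeight (p : E → ℝ) (O : Finset E) : ℝ := ∏ e, if e ∈ O then p e else 1 - p e

lemma isingWeight_eq (ends : E → V × V) (a : E → ℝ) (σ : V → ℤˣ) :
    isingWeight ends a σ
      = ∑ O : Finset E, (∏ e ∈ O, a e) * if Compatible ends O σ then 1 else 0 := by
  rw [isingWeight, Finset.prod_one_add, Finset.powerset_univ]
  refine Finset.sum_congr rfl fun O _ => ?_
  by_cases h : Compatible ends O σ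
  · rw [if_pos h, mul_one]
    exact Finset.prod_congr rfl fun e he => if_pos (h e he)
  · rw [if_neg h, mul_zero]
    simp only [Compatible, not_forall] at h
    obtain ⟨e, he, hne⟩ := h
    exact Finset.prod_eq_zero he (if_neg hne)

lemma sum_isingWeight (ends : E → V × V) (a : E → ℝ) :
    ∑ σ, isingWeight ends a σ = ∑ O, clusterWeight ends a O := by
  simp only [isingWeight_eq, clusterWeight, numCompatible, Finset.mul_sum]
  exact Finset.sum_comm

lemma sum_spinProd_mul_isingWeight (ends : E → V × V) (a : E → ℝ) (x y : V) :
    ∑ σ, spinProd σ x y * isingWeight ends a σ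
      = ∑ O, (if Linked ends O x y then 1 else 0) * clusterWeight ends a O := by
  simp only [isingWeight_eq, clusterWeight, Finset.mul_sum]
  rw [Finset.sum_comm]
  refine Finset.sum_congr rfl fun O _ => ?_
  have := sum_compatible_spinProd ends O x y
  calc _ = (∏ e ∈ O, a e) * ∑ σ, if Compatible ends O σ then spinProd σ x y else 0 := by
        rw [Finset.mul_sum]
        refine Finset.sum_congr rfl fun σ _ => ?_
        split_ifs <;> ring
    _ = _ := by
        rw [this]
        split_ifs <;> ring

lemma sum_bernoulliWeight (p : E → ℝ) : ∑ O, bernoulliWeight p O = 1 := by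
  have := Finset.prod_add p (fun e => 1 - p e) Finset.univ
  simp only [add_sub_cancel, Finset.prod_const_one, Finset.powerset_univ] at this
  rw [this]
  refine Finset.sum_congr rfl fun O _ => ?_
  rw [bernoulliWeight, Finset.prod_ite]
  congr 1 <;> refine Finset.prod_congr ?_ fun _ _ => rfl <;> ext e <;> simp

lemma clusterWeight_nonneg (ends : E → V × V) {a : E → ℝ} (ha : 0 ≤ a) (O : Finset E) :
    0 ≤ clusterWeight ends a O :=
  mul_nonneg (Finset.prod_nonneg fun e _ => ha e) (numCompatible_pos ends O).le

lemma sum_clusterWeight_pos (ends : E → V × V) {a : E → ℝ} (ha : 0 ≤ a) :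
    0 < ∑ O, clusterWeight ends a O := by
  refine Finset.sum_pos' (fun O _ => clusterWeight_nonneg ends ha O) ⟨∅, Finset.mem_univ _, ?_⟩
  simpa [clusterWeight] using numCompatible_pos ends ∅

/-- Holley's condition between two couplings. Only the edges of `O \ O'` change sides: their weights
grow from `a` to `b`, and the cluster factor is supermodular. -/
lemma clusterWeight_mul_le (ends : E → V × V) {a b : E → ℝ} (ha : 0 ≤ a) (hab : a ≤ b)
    (O O' : Finset E) :
    clusterWeight ends a O * clusterWeight ends b O'
      ≤ clusterWeight ends a (O ∩ O') * clusterWeight ends b (O ∪ O') := by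
  have hN := numCompatible_union_mul_le ends (Finset.inter_subset_right (s₁ := O) (s₂ := O'))
    (O \ O')
  have e1 : O ∩ O' ∪ O \ O' = O := by ext; simp; tauto
  have e2 : O' ∪ O \ O' = O ∪ O' := by ext; simp; tauto
  rw [e1, e2] at hN
  have p1 : ∏ e ∈ O, a e = (∏ e ∈ O ∩ O', a e) * ∏ e ∈ O \ O', a e := by
    conv_lhs => rw [← e1]
    exact Finset.prod_union (by
      rw [Finset.disjoint_left]; intro x; simp; tauto)
  have p2 : ∏ e ∈ O ∪ O', b e = (∏ e ∈ O', b e) * ∏ e ∈ O \ O', b e := by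
    rw [← e2]
    exact Finset.prod_union Finset.disjoint_sdiff
  have hb : 0 ≤ b := ha.trans hab
  have p3 : ∏ e ∈ O \ O', a e ≤ ∏ e ∈ O \ O', b e :=
    Finset.prod_le_prod (fun e _ => ha e) fun e _ => hab e
  unfold clusterWeight
  rw [p1, p2]
  have h1 : 0 ≤ ∏ e ∈ O ∩ O', a e := Finset.prod_nonneg fun e _ => ha e
  have h2 : 0 ≤ ∏ e ∈ O', b e := Finset.prod_nonneg fun e _ => hb e
  have h3 : 0 ≤ ∏ e ∈ O \ O', a e := Finset.prod_nonneg fun e _ => ha e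
  have h4 := mul_le_mul p3 hN (mul_pos (numCompatible_pos _ _) (numCompatible_pos _ _)).le
    (h3.trans p3)
  have h5 := mul_le_mul_of_nonneg_left h4 (mul_nonneg h1 h2)
  linarith

/-- Moving an edge of `O \ O'` over replaces `p` by `1 - p` on the Bernoulli side. On the other side
it contributes `a` and costs at most a factor 2 in the number of compatible configurations; `hpa`
says exactly that this trade is favourable. -/
lemma bernoulliWeight_mul_clusterWeight_le (ends : E → V × V) {a p : E → ℝ} (ha : 0 ≤ a)
    (hp : ∀ e, 0 ≤ p e) (hp1 : ∀ e, p e ≤ 1) (hpa : ∀ e, 2 * p e ≤ a e * (1 - p e))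
    (O O' : Finset E) :
    bernoulliWeight p O * clusterWeight ends a O'
      ≤ bernoulliWeight p (O ∩ O') * clusterWeight ends a (O ∪ O') := by
  have hN := numCompatible_le_two_pow_mul ends O' (O \ O')
  have e1 : O ∩ O' ∪ O \ O' = O := by ext; simp; tauto
  have e2 : O' ∪ O \ O' = O ∪ O' := by ext; simp; tauto
  rw [e2] at hN
  have p2 : ∏ e ∈ O ∪ O', a e = (∏ e ∈ O', a e) * ∏ e ∈ O \ O', a e := by
    rw [← e2]
    exact Finset.prod_union Finset.disjoint_sdiff
  have hsplit : ∀ f : E → ℝ, ∏ e, f e = (∏ e ∈ O \ O', f e) * ∏ e ∈ (O \ O')ᶜ, f e :=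
    fun f => (Finset.prod_mul_prod_compl _ _).symm
  have q1 : bernoulliWeight p O = (∏ e ∈ O \ O', p e) *
      ∏ e ∈ (O \ O')ᶜ, if e ∈ O then p e else 1 - p e := by
    rw [bernoulliWeight, hsplit]
    congr 1
    exact Finset.prod_congr rfl fun e he => if_pos (Finset.mem_sdiff.1 he).1
  have q2 : bernoulliWeight p (O ∩ O') = (∏ e ∈ O \ O', (1 - p e)) *
      ∏ e ∈ (O \ O')ᶜ, if e ∈ O then p e else 1 - p e := by
    rw [bernoulliWeight, hsplit]
    congr 1
    · refine Finset.prod_congr rfl fun e he => if_neg ?_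
      simp only [Finset.mem_sdiff, Finset.mem_inter] at *
      tauto
    · refine Finset.prod_congr rfl fun e he => ?_
      simp only [Finset.mem_compl, Finset.mem_sdiff, Finset.mem_inter] at *
      split_ifs <;> tauto
  unfold clusterWeight
  rw [q1, q2, p2]
  have h1 : 0 ≤ ∏ e ∈ (O \ O')ᶜ, if e ∈ O then p e else 1 - p e :=
    Finset.prod_nonneg fun e _ => by
      have := hp e; have := hp1 e
      split_ifs <;> linarith
  have h2 : 0 ≤ ∏ e ∈ O', a e := Finset.prod_nonneg fun e _ => ha e
  have h3 : 0 ≤ ∏ e ∈ O \ O', p e := Finset.prod_nonneg fun e _ => hp e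
  have h4 : 2 ^ (O \ O').card * ∏ e ∈ O \ O', p e
      ≤ (∏ e ∈ O \ O', a e) * ∏ e ∈ O \ O', (1 - p e) := by
    rw [← Finset.prod_const, ← Finset.prod_mul_distrib, ← Finset.prod_mul_distrib]
    exact Finset.prod_le_prod (fun e _ => by have := hp e; positivity) fun e _ => hpa e
  have h5 := mul_le_mul_of_nonneg_left hN h3
  have h6 := mul_le_mul_of_nonneg_right h4 (numCompatible_pos ends (O ∪ O')).le
  have h7 := mul_le_mul_of_nonneg_left (h5.trans (le_of_eq_of_le (by ring) h6))
    (mul_nonneg h1 h2)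
  linarith

/-- Comparison of two normalised weights on edge sets satisfying Holley's condition. -/
lemma sum_linked_div_le {f g : Finset E → ℝ} (hf : 0 ≤ f) (hg : 0 ≤ g) (hf' : 0 < ∑ O, f O)
    (hg' : 0 < ∑ O, g O) (h : ∀ O O', f O * g O' ≤ f (O ∩ O') * g (O ∪ O'))
    (ends : E → V × V) (x y : V) :
    (∑ O, (if Linked ends O x y then 1 else 0) * f O) / ∑ O, f O
      ≤ (∑ O, (if Linked ends O x y then 1 else 0) * g O) / ∑ O, g O := by
  -- Holley's inequality needs equal total masses, so each weight is multiplied by the total of the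
  -- other.
  have key := holley (α := Finset E) (μ := fun O => if Linked ends O x y then (1 : ℝ) else 0)
    (f := fun O => f O * ∑ O, g O) (g := fun O => (∑ O, f O) * g O)
    (fun O => by dsimp only; split_ifs <;> simp)
    (fun O => mul_nonneg (hf O) hg'.le) (fun O => mul_nonneg hf'.le (hg O))
    (fun O O' hO => by
      dsimp only
      by_cases hl : Linked ends O x y
      · rw [if_pos hl, if_pos (hl.mono hO)]
      · rw [if_neg hl]; split_ifs <;> norm_num)
    (by rw [← Finset.sum_mul, ← Finset.mul_sum])
    (fun O O' => by
      have := mul_le_mul_of_nonneg_left (h O O') (mul_nonneg hf'.le hg'.le)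
      simp only [Finset.inf_eq_inter, Finset.sup_eq_union]
      linarith)
  rw [div_le_div_iff₀ hf' hg', Finset.sum_mul, Finset.sum_mul]
  refine le_of_eq_of_le (Finset.sum_congr rfl fun O _ => ?_)
    (key.trans_eq (Finset.sum_congr rfl fun O _ => ?_)) <;> ring

/-- Griffiths' second inequality: correlations increase with the couplings. -/
lemma ising_correlation_mono (ends : E → V × V) {a b : E → ℝ} (ha : 0 ≤ a) (hab : a ≤ b)
    (x y : V) :
    (∑ σ, spinProd σ x y * isingWeight ends a σ) / ∑ σ, isingWeight ends a σ
      ≤ (∑ σ, spinProd σ x y * isingWeight ends b σ) / ∑ σ, isingWeight ends b σ := by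
  simp only [sum_spinProd_mul_isingWeight, sum_isingWeight]
  exact sum_linked_div_le (fun O => clusterWeight_nonneg ends ha O)
    (fun O => clusterWeight_nonneg ends (ha.trans hab) O) (sum_clusterWeight_pos ends ha)
    (sum_clusterWeight_pos ends (ha.trans hab)) (clusterWeight_mul_le ends ha hab) ends x y

/-- Ising correlations dominate connection probabilities of Bernoulli percolation. -/
lemma percolation_le_ising_correlation (ends : E → V × V) {a p : E → ℝ} (ha : 0 ≤ a)
    (hp : ∀ e, 0 ≤ p e) (hp1 : ∀ e, p e ≤ 1) (hpa : ∀ e, 2 * p e ≤ a e * (1 - p e)) (x y : V) :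
    ∑ O, (if Linked ends O x y then 1 else 0) * bernoulliWeight p O
      ≤ (∑ σ, spinProd σ x y * isingWeight ends a σ) / ∑ σ, isingWeight ends a σ := by
  simp only [sum_spinProd_mul_isingWeight, sum_isingWeight]
  have := sum_linked_div_le (f := bernoulliWeight p) (fun O => Finset.prod_nonneg fun e _ => by
      have := hp e; have := hp1 e
      split_ifs <;> linarith)
    (fun O => clusterWeight_nonneg ends ha O) (by rw [sum_bernoulliWeight]; norm_num)
    (sum_clusterWeight_pos ends ha)
    (bernoulliWeight_mul_clusterWeight_le ends ha hp hp1 hpa) ends x y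
  rwa [sum_bernoulliWeight, div_one] at this

end Discrete

/-! ### The walk -/

section Walk

/-- The law of the sequence of waiting times. -/
def waitLaw : Measure (ℕ → ℝ) := Measure.infinitePi fun _ : ℕ => expMeasure 1

instance : IsProbabilityMeasure (expMeasure 1) := isProbabilityMeasure_expMeasure one_pos

instance : IsProbabilityMeasure waitLaw := by unfold waitLaw; infer_instance

/-- The number of jumps up to time `t`, as a function of the waiting times. -/
def jumpCount (w : ℕ → ℝ) (t : ℝ) : ℕ := {k : ℕ | ∑ i ∈ Finset.range (k + 1), w i ≤ t}.ncard

/-- The spin at time `t` of the walk started in `1`. -/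
def parity (w : ℕ → ℝ) (t : ℝ) : ℝ := (-1) ^ jumpCount w t

lemma spin_eq (t : ℝ) (ω : PathSpace) : spin t ω = ω.1 * parity ω.2 t := rfl

lemma parity_eq_or (w : ℕ → ℝ) (t : ℝ) : parity w t = 1 ∨ parity w t = -1 :=
  neg_one_pow_eq_or ℝ _

lemma abs_parity (w : ℕ → ℝ) (t : ℝ) : |parity w t| = 1 := by
  rcases parity_eq_or w t with h | h <;> simp [h]

/-- The waiting times are positive and add up to infinity. -/
def Regular (w : ℕ → ℝ) : Prop :=
  (∀ i, 0 < w i) ∧ ∀ t, {k : ℕ | ∑ i ∈ Finset.range (k + 1), w i ≤ t}.Finite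

lemma Regular.jumpCount_of_lt {w : ℕ → ℝ} (hw : Regular w) {t : ℝ} (ht : t < w 0) :
    jumpCount w t = 0 := by
  rw [jumpCount, Set.ncard_eq_zero (hw.2 t), Set.eq_empty_iff_forall_notMem]
  intro k hk
  have := Finset.sum_le_sum_of_subset_of_nonneg (f := w)
    (show Finset.range 1 ⊆ Finset.range (k + 1) by simp) fun i _ _ => (hw.1 i).le
  simp only [Finset.sum_range_one, Set.mem_ofPred_eq] at this hk
  linarith

lemma Regular.parity_zero {w : ℕ → ℝ} (hw : Regular w) : parity w 0 = 1 := by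
  rw [parity, hw.jumpCount_of_lt (hw.1 0), pow_zero]

/-- Right-continuity of the path: only finitely many jumps occur before `t + 1`, so those after `t`
keep a positive distance from `t`. -/
lemma Regular.eventually_parity_eq {w : ℕ → ℝ} (hw : Regular w) (t : ℝ) :
    ∀ᶠ s in 𝓝[≥] t, parity w s = parity w t := by
  have h1 : ∀ᶠ s in 𝓝[≥] t, s ∈ Set.Ico t (t + 1) :=
    Ico_mem_nhdsGE (by linarith)
  have h2 : ∀ᶠ s in 𝓝[≥] t, ∀ k ∈ {k : ℕ | ∑ i ∈ Finset.range (k + 1), w i ≤ t + 1},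
      t < ∑ i ∈ Finset.range (k + 1), w i → s < ∑ i ∈ Finset.range (k + 1), w i := by
    rw [Filter.eventually_all_finite (hw.2 (t + 1))]
    intro k _
    by_cases h : t < ∑ i ∈ Finset.range (k + 1), w i
    · filter_upwards [Ico_mem_nhdsGE h] with s hs _ using hs.2
    · exact Eventually.of_forall fun s h' => absurd h' h
  filter_upwards [h1, h2] with s hs hk
  have : {k : ℕ | ∑ i ∈ Finset.range (k + 1), w i ≤ s}
      = {k : ℕ | ∑ i ∈ Finset.range (k + 1), w i ≤ t} := by
    ext k
    simp only [Set.mem_ofPred_eq]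
    refine ⟨fun h => ?_, fun h => h.trans hs.1⟩
    by_contra! hc
    exact absurd (hk k (show _ ≤ t + 1 by linarith [hs.2]) hc) (not_lt.2 h)
  rw [parity, parity, jumpCount, jumpCount, this]

lemma measurable_jumpCount : Measurable fun p : (ℕ → ℝ) × ℝ => jumpCount p.1 p.2 := by
  have h : (fun p : (ℕ → ℝ) × ℝ => jumpCount p.1 p.2) = fun p => ⌊(∑' k : ℕ,
      {p : (ℕ → ℝ) × ℝ | ∑ i ∈ Finset.range (k + 1), p.1 i ≤ p.2}.indicator
        (fun _ => (1 : ℝ≥0∞)) p).toReal⌋₊ := by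
    funext p
    have h1 := tsum_subtype {k : ℕ | ∑ i ∈ Finset.range (k + 1), p.1 i ≤ p.2}
      (fun _ => (1 : ℝ≥0∞))
    rw [ENNReal.tsum_set_one] at h1
    have h2 : (∑' k : ℕ, {p : (ℕ → ℝ) × ℝ | ∑ i ∈ Finset.range (k + 1), p.1 i ≤ p.2}.indicator
        (fun _ => (1 : ℝ≥0∞)) p)
        = ({k : ℕ | ∑ i ∈ Finset.range (k + 1), p.1 i ≤ p.2}.encard : ℝ≥0∞) := h1.symm
    rw [h2, jumpCount, Set.ncard]
    rcases eq_or_ne {k : ℕ | ∑ i ∈ Finset.range (k + 1), p.1 i ≤ p.2}.encard ⊤ with h3 | h3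
    -- For infinitely many jumps, `ncard` and `toReal` of infinity both default to 0.
    · simp [h3]
    · obtain ⟨n, hn⟩ := ENat.ne_top_iff_exists.1 h3
      simp [← hn]
  rw [h]
  refine Nat.measurable_floor.comp (Measurable.ennreal_toReal (Measurable.tsum fun k => ?_))
  refine measurable_const.indicator (measurableSet_le ?_ measurable_snd)
  fun_prop

lemma measurable_parity_uncurry : Measurable fun p : (ℕ → ℝ) × ℝ => parity p.1 p.2 := by
  have h : Measurable fun k : ℕ => (-1 : ℝ) ^ k := measurable_from_top
  have := h.comp measurable_jumpCount
  unfold parity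
  exact this

lemma measurable_parity (t : ℝ) : Measurable fun w : ℕ → ℝ => parity w t := by
  have h : Measurable fun w : ℕ → ℝ => ((w, t) : (ℕ → ℝ) × ℝ) := measurable_prodMk_right
  have h2 := measurable_parity_uncurry.comp h
  simpa only [Function.comp_def] using h2

/-- The sequence `w` with `s` put in front. -/
def consSeq (s : ℝ) (w : ℕ → ℝ) : ℕ → ℝ
  | 0 => s
  | n + 1 => w n

lemma sum_consSeq (s : ℝ) (w : ℕ → ℝ) (k : ℕ) :
    ∑ i ∈ Finset.range (k + 1), consSeq s w i = s + ∑ i ∈ Finset.range k, w i := by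
  rw [Finset.sum_range_succ', add_comm]
  rfl

lemma measurable_consSeq : Measurable fun p : ℝ × (ℕ → ℝ) => consSeq p.1 p.2 := by
  refine measurable_pi_iff.2 fun n => ?_
  cases n with
  | zero => exact measurable_fst
  | succ n => exact (measurable_pi_apply n).comp measurable_snd

lemma measurePreserving_consSeq :
    MeasurePreserving (fun p : ℝ × (ℕ → ℝ) => consSeq p.1 p.2)
      ((expMeasure 1).prod waitLaw) waitLaw := by
  refine ⟨measurable_consSeq, Measure.eq_infinitePi _ fun s t ht => ?_⟩
  obtain ⟨N, hN⟩ := s.exists_nat_subset_range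
  -- Padding with `univ` replaces `s` by an initial segment, on which prepending an entry is a plain
  -- index shift.
  let t' : ℕ → Set ℝ := fun i => if i ∈ s then t i else Set.univ
  have ht' : ∀ i, MeasurableSet (t' i) := fun i => by
    dsimp only [t']; split_ifs; exacts [ht i, .univ]
  have h1 : Set.pi s t = Set.pi (Finset.range (N + 1)) t' := by
    ext x
    simp only [Set.mem_pi, Finset.mem_coe, t']
    refine ⟨fun h i _ => ?_, fun h i hi => ?_⟩
    · split_ifs with hi
      exacts [h i hi, trivial]
    · have := h i (Finset.mem_range.2 ((Finset.mem_range.1 (hN hi)).trans (Nat.lt_succ_self N)))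
      rwa [if_pos hi] at this
  have h2 : ∏ i ∈ s, expMeasure 1 (t i) = ∏ i ∈ Finset.range (N + 1), expMeasure 1 (t' i) := by
    rw [← Finset.prod_subset (hN.trans (Finset.range_subset_range.2 (Nat.le_succ N)))]
    · exact Finset.prod_congr rfl fun i hi => by rw [show t' i = t i from if_pos hi]
    · intro i _ hi
      rw [show t' i = Set.univ from if_neg hi, measure_univ]
  rw [h1, h2, Measure.map_apply measurable_consSeq (.pi (Finset.countable_toSet _) fun i _ => ht' i)]
  have h3 : (fun p : ℝ × (ℕ → ℝ) => consSeq p.1 p.2) ⁻¹' Set.pi (Finset.range (N + 1)) t'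
      = t' 0 ×ˢ Set.pi (Finset.range N) fun i => t' (i + 1) := by
    ext p
    simp only [Set.mem_preimage, Set.mem_pi, Finset.mem_coe, Finset.mem_range, Set.mem_prod]
    refine ⟨fun h => ⟨h 0 (Nat.succ_pos N), fun i hi => h (i + 1) (Nat.succ_lt_succ hi)⟩, ?_⟩
    rintro ⟨h0, hs⟩ (_ | i) hi
    exacts [h0, hs i (Nat.lt_of_succ_lt_succ hi)]
  rw [h3, Measure.prod_prod, waitLaw, Measure.infinitePi_pi _ fun i _ => ht' (i + 1),
    Finset.prod_range_succ', mul_comm]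

lemma expMeasure_Iic {t : ℝ} (ht : 0 ≤ t) :
    expMeasure 1 (Set.Iic t) = ENNReal.ofReal (1 - Real.exp (-t)) := by
  rw [← ofReal_cdf, cdf_expMeasure_eq one_pos, if_pos ht, one_mul]

lemma ae_pos_expMeasure : ∀ᵐ s ∂(expMeasure 1), 0 < s := by
  have := expMeasure_Iic le_rfl
  simp only [neg_zero, Real.exp_zero, sub_self, ENNReal.ofReal_zero] at this
  rw [ae_iff]
  simpa [Set.Iic] using this

lemma integral_expMeasure (f : ℝ → ℝ) :
    ∫ s, f s ∂(expMeasure 1) = ∫ s in Set.Ioi 0, Real.exp (-s) * f s := by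
  rw [expMeasure, gammaMeasure, integral_withDensity_eq_integral_toReal_smul
    (f := gammaPDF 1 1) (measurable_gammaPDFReal 1 1).ennreal_ofReal (by simp [gammaPDF]),
    ← integral_Ici_eq_integral_Ioi, ← integral_indicator measurableSet_Ici]
  refine integral_congr_ae (Eventually.of_forall fun s => ?_)
  by_cases hs : 0 ≤ s
  · simp [gammaPDF_of_nonneg hs, hs, (Real.exp_pos _).le]
  · simp [gammaPDF_of_neg (not_le.1 hs), hs]

/-- Almost surely some waiting time exceeds any given `N`, because k independent ones all stay below
it with probability (1 - e^{-N})^k. From that index on, the partial sums exceed `N`, which rules out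
infinitely many jumps in bounded time. -/
lemma ae_regular : ∀ᵐ w ∂waitLaw, Regular w := by
  have h1 : ∀ᵐ w ∂waitLaw, ∀ i, 0 < w i := by
    rw [ae_all_iff]
    intro i
    exact (measurePreserving_eval_infinitePi (fun _ : ℕ => expMeasure 1) i).quasiMeasurePreserving.ae
      ae_pos_expMeasure
  have h2 : ∀ᵐ w ∂waitLaw, ∀ N : ℕ, ∃ i, (N : ℝ) < w i := by
    rw [ae_all_iff]
    intro N
    rw [ae_iff]
    refine le_antisymm (ge_of_tendsto' (f := fun k : ℕ => ENNReal.ofReal (1 - Real.exp (-N)) ^ k)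
      (x := atTop) ?_ fun k => ?_) zero_le
    · refine ENNReal.tendsto_pow_atTop_nhds_zero_of_lt_one ?_
      rw [← ENNReal.ofReal_one, ENNReal.ofReal_lt_ofReal_iff one_pos]
      linarith [Real.exp_pos (-N : ℝ)]
    · calc _ ≤ waitLaw (Set.pi (Finset.range k) fun _ => Set.Iic (N : ℝ)) :=
            measure_mono fun w hw i _ => by
              simp only [not_exists, not_lt, Set.mem_ofPred_eq] at hw
              exact hw i
        _ = _ := by
          rw [waitLaw, Measure.infinitePi_pi _ fun i _ => measurableSet_Iic]
          simp [expMeasure_Iic]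
  filter_upwards [h1, h2] with w hw1 hw2
  refine ⟨hw1, fun t => ?_⟩
  obtain ⟨N, hN⟩ := exists_nat_ge t
  obtain ⟨i, hi⟩ := hw2 N
  refine (Set.finite_lt_nat i).subset fun k hk => ?_
  simp only [Set.mem_ofPred_eq] at hk ⊢
  by_contra! hik
  have := Finset.single_le_sum (f := w) (fun j _ => (hw1 j).le)
    (Finset.mem_range.2 (Nat.lt_succ_of_le hik))
  simp only [Nat.succ_eq_add_one] at this
  linarith

lemma Regular.jumpCount_consSeq {w : ℕ → ℝ} (hw : Regular w) {s t : ℝ} (hst : s ≤ t) :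
    jumpCount (consSeq s w) t = jumpCount w (t - s) + 1 := by
  have h : {k : ℕ | ∑ i ∈ Finset.range (k + 1), consSeq s w i ≤ t}
      = insert 0 (Nat.succ '' {k : ℕ | ∑ i ∈ Finset.range (k + 1), w i ≤ t - s}) := by
    ext k
    simp only [sum_consSeq, Set.mem_ofPred_eq, Set.mem_insert_iff, Set.mem_image]
    cases k with
    | zero => simpa using hst
    | succ k => simp [le_sub_iff_add_le']
  rw [jumpCount, h, Set.ncard_insert_of_notMem (by simp) ((hw.2 _).image _),
    Set.ncard_image_of_injective _ Nat.succ_injective, jumpCount]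

lemma Regular.parity_consSeq {w : ℕ → ℝ} (hw : Regular w) {s t : ℝ} (hst : s ≤ t) :
    parity (consSeq s w) t = -parity w (t - s) := by
  rw [parity, hw.jumpCount_consSeq hst, pow_succ, parity]
  ring

lemma parity_consSeq_add (w : ℕ → ℝ) (s a t : ℝ) :
    parity (consSeq (s + a) w) (a + t) = parity (consSeq s w) t := by
  have : ∀ x : ℝ, s + a + x ≤ a + t ↔ s + x ≤ t := fun x => by constructor <;> intro <;> linarith
  simp only [parity, jumpCount, sum_consSeq, this]

end Walk

/-! ### The Markov property, through a renewal equation. -/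

section Markov

/-- Mean of a functional of the walk sampled at the times `a, a + h, a + 2h, …`. -/
def sampledMean (Φ : (ℕ → ℝ) → ℝ) (h a y : ℝ) : ℝ :=
  ∫ w, Φ (fun i => y * parity w (a + i * h)) ∂waitLaw

variable {Φ : (ℕ → ℝ) → ℝ} {C : ℝ}

lemma measurable_sampled (hΦ : Measurable Φ) (h y : ℝ) :
    Measurable fun p : ℝ × (ℕ → ℝ) => Φ fun i => y * parity p.2 (p.1 + i * h) := by
  refine hΦ.comp (measurable_pi_iff.2 fun i => Measurable.const_mul ?_ y)
  have h1 : Measurable fun p : ℝ × (ℕ → ℝ) => (p.2, p.1 + i * h) := by fun_prop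
  simpa only [Function.comp_def] using measurable_parity_uncurry.comp h1

lemma measurable_sampledMean (hΦ : Measurable Φ) (h y : ℝ) :
    Measurable fun a => sampledMean Φ h a y :=
  ((measurable_sampled hΦ h y).stronglyMeasurable.integral_prod_right' (ν := waitLaw)).measurable

lemma abs_sampledMean_le (hC : ∀ x, |Φ x| ≤ C) (h a y : ℝ) : |sampledMean Φ h a y| ≤ C := by
  have := norm_integral_le_of_norm_le_const (μ := waitLaw)
    (f := fun w => Φ (fun i => y * parity w (a + i * h))) (C := C)
    (Eventually.of_forall fun w => hC _)
  simpa [sampledMean] using this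

lemma integrableOn_exp_neg_mul {K : ℝ → ℝ} (hK : Measurable K) (hC : ∀ s, |K s| ≤ C) :
    IntegrableOn (fun s => Real.exp (-s) * K s) (Set.Ioi 0) :=
  Integrable.mul_bdd (c := C) (by simpa [IntegrableOn] using exp_neg_integrableOn_Ioi 0 one_pos)
    hK.aestronglyMeasurable (Eventually.of_forall hC)

/-- Conditioning on the first jump time `s`: if `s ≤ a`, the walk restarts with reversed sign and
remaining delay `a - s`; otherwise the exponential law is memoryless. -/
lemma sampledMean_renewal (hΦ : Measurable Φ) (hC : ∀ x, |Φ x| ≤ C) (h : ℝ) (hh : 0 ≤ h)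
    {a : ℝ} (ha : 0 ≤ a) (y : ℝ) :
    sampledMean Φ h a y = (∫ s in 0..a, Real.exp (-s) * sampledMean Φ h (a - s) (-y))
      + Real.exp (-a) * sampledMean Φ h 0 y := by
  -- The conditional mean with delay `b`, given that the first jump happens at `s`; it is needed for
  -- `b = a` and `b = 0`.
  let K : ℝ → ℝ → ℝ := fun b s => ∫ w, Φ (fun i => y * parity (consSeq s w) (b + i * h)) ∂waitLaw
  have hm : ∀ b, Measurable fun p : ℝ × (ℕ → ℝ) =>
      Φ (fun i => y * parity (consSeq p.1 p.2) (b + i * h)) := fun b => by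
    have h1 : Measurable fun p : ℝ × (ℕ → ℝ) => (b, consSeq p.1 p.2) :=
      measurable_const.prodMk measurable_consSeq
    simpa only [Function.comp_def] using (measurable_sampled hΦ h y).comp h1
  have hKm : ∀ b, Measurable (K b) := fun b =>
    ((hm b).stronglyMeasurable.integral_prod_right' (ν := waitLaw)).measurable
  have hKC : ∀ b s, |K b s| ≤ C := fun b s => by
    have := norm_integral_le_of_norm_le_const (μ := waitLaw)
      (f := fun w => Φ (fun i => y * parity (consSeq s w) (b + i * h))) (C := C)
      (Eventually.of_forall fun w => hC _)
    simpa [K] using this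
  have hv : ∀ b, sampledMean Φ h b y = ∫ s in Set.Ioi 0, Real.exp (-s) * K b s := fun b => by
    have h2 : Measurable fun w : ℕ → ℝ => Φ (fun i => y * parity w (b + i * h)) := by
      have h1 : Measurable fun w : ℕ → ℝ => (b, w) := measurable_prodMk_left
      simpa only [Function.comp_def] using (measurable_sampled hΦ h y).comp h1
    rw [← integral_expMeasure, sampledMean, ← measurePreserving_consSeq.map_eq,
      integral_map measurable_consSeq.aemeasurable h2.aestronglyMeasurable, integral_prod]
    exact Integrable.of_bound (hm b).aestronglyMeasurable C (Eventually.of_forall fun p => hC _)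
  have hint := integrableOn_exp_neg_mul (hKm a) (hKC a)
  rw [hv a, ← Set.Ioc_union_Ioi_eq_Ioi ha, setIntegral_union (Set.Ioc_disjoint_Ioi le_rfl)
    measurableSet_Ioi (hint.mono_set Set.Ioc_subset_Ioi_self)
    (hint.mono_set (Set.Ioi_subset_Ioi ha)), intervalIntegral.integral_of_le ha]
  congr 1
  · refine setIntegral_congr_fun measurableSet_Ioc fun s hs => ?_
    dsimp only [K, sampledMean]
    congr 1
    refine integral_congr_ae ?_
    filter_upwards [ae_regular] with w hw
    congr 1
    funext i
    have : 0 ≤ i * h := by positivity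
    rw [hw.parity_consSeq (by linarith [hs.2])]
    rw [show a + i * h - s = a - s + i * h by ring]
    ring
  -- Memorylessness is the substitution s ↦ s + a, which leaves the factor e^{-a}.
  · rw [hv 0, ← integral_const_mul]
    have h3 := (measurePreserving_add_right volume a).setIntegral_preimage_emb
      (measurableEmbedding_addRight a) (fun s => Real.exp (-s) * K a s) (Set.Ioi a)
    rw [← h3]
    have h4 : (fun x : ℝ => x + a) ⁻¹' Set.Ioi a = Set.Ioi 0 := by ext; simp
    rw [h4]
    refine setIntegral_congr_fun measurableSet_Ioi fun s _ => ?_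
    dsimp only [K]
    simp only [parity_consSeq_add, zero_add]
    rw [neg_add, Real.exp_add]
    ring

/-- The renewal kernel on `[0, a]` has mass 1 - e^{-a} < 1, so iterating the homogeneous equation
contracts any bounded solution to zero. -/
lemma renewal_unique {d : ℝ → ℝ → ℝ} (hC : ∀ a y, 0 ≤ a → |d a y| ≤ C)
    (hd : ∀ a y, 0 ≤ a → d a y = ∫ s in 0..a, Real.exp (-s) * d (a - s) (-y))
    {a : ℝ} (ha : 0 ≤ a) (y : ℝ) : d a y = 0 := by
  have hr0 : 0 ≤ 1 - Real.exp (-a) := by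
    have : Real.exp (-a) ≤ 1 := Real.exp_le_one_iff.2 (by linarith)
    linarith
  have hC0 : 0 ≤ C := (abs_nonneg _).trans (hC a y ha)
  have key : ∀ k : ℕ, ∀ b y, 0 ≤ b → b ≤ a → |d b y| ≤ C * (1 - Real.exp (-a)) ^ k := by
    intro k
    induction k with
    | zero => intro b y hb _; simpa using hC b y hb
    | succ k ih =>
      intro b y hb hba
      have h1 : ‖∫ s in 0..b, Real.exp (-s) * d (b - s) (-y)‖
          ≤ ∫ s in 0..b, Real.exp (-s) * (C * (1 - Real.exp (-a)) ^ k) := by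
        refine intervalIntegral.norm_integral_le_of_norm_le hb
          (Eventually.of_forall fun s hs => ?_) (Continuous.intervalIntegrable (by fun_prop) _ _)
        rw [norm_mul, Real.norm_of_nonneg (Real.exp_pos _).le]
        exact mul_le_mul_of_nonneg_left (ih _ _ (by linarith [hs.2]) (by linarith [hs.1]))
          (Real.exp_pos _).le
      rw [← hd b y hb, intervalIntegral.integral_mul_const] at h1
      have h2 : ∫ s in 0..b, Real.exp (-s) = 1 - Real.exp (-b) := by
        simp [intervalIntegral.integral_comp_neg (fun x => Real.exp x)]
      rw [h2] at h1
      refine h1.trans ?_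
      rw [pow_succ, mul_comm, ← mul_assoc]
      refine mul_le_mul_of_nonneg_left ?_ (by positivity)
      have := Real.exp_le_exp.2 (show -a ≤ -b by linarith)
      linarith
  have hlim : Tendsto (fun k : ℕ => C * (1 - Real.exp (-a)) ^ k) atTop (𝓝 0) := by
    simpa using (tendsto_pow_atTop_nhds_zero_of_lt_one hr0
      (by linarith [Real.exp_pos (-a)])).const_mul C
  exact abs_eq_zero.1 (le_antisymm (ge_of_tendsto' hlim fun k => key k a y ha le_rfl)
    (abs_nonneg _))

/-- The Markov property of the walk at a deterministic time. -/
lemma sampledMean_markov (hΦ : Measurable Φ) (hC : ∀ x, |Φ x| ≤ C) {h : ℝ} (hh : 0 ≤ h)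
    {a : ℝ} (ha : 0 ≤ a) (y : ℝ) :
    sampledMean Φ h a y = (1 + Real.exp (-2 * a)) / 2 * sampledMean Φ h 0 y
      + (1 - Real.exp (-2 * a)) / 2 * sampledMean Φ h 0 (-y) := by
  have hexp : ∀ b : ℝ, 0 ≤ b → Real.exp (-2 * b) ≤ 1 := fun b hb =>
    Real.exp_le_one_iff.2 (by linarith)
  have hC0 : 0 ≤ C := (abs_nonneg _).trans (hC 0)
  -- The explicit two-state semigroup with flip rate 1. It solves the same renewal equation, and
  -- uniqueness then identifies it with `sampledMean`.
  let c : ℝ → ℝ → ℝ := fun a y => (1 + Real.exp (-2 * a)) / 2 * sampledMean Φ h 0 y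
      + (1 - Real.exp (-2 * a)) / 2 * sampledMean Φ h 0 (-y)
  have hc : ∀ a y, 0 ≤ a → c a y = (∫ s in 0..a, Real.exp (-s) * c (a - s) (-y))
      + Real.exp (-a) * sampledMean Φ h 0 y := by
    intro a y ha
    have h1 : ∀ s, Real.exp (-s) * c (a - s) (-y)
        = Real.exp (-s) * ((sampledMean Φ h 0 y + sampledMean Φ h 0 (-y)) / 2)
          - Real.exp s * (Real.exp (-2 * a) *
            ((sampledMean Φ h 0 y - sampledMean Φ h 0 (-y)) / 2)) := by
      intro s
      have : Real.exp (-2 * (a - s)) = Real.exp (-2 * a) * (Real.exp s * Real.exp s) := by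
        rw [← Real.exp_add, ← Real.exp_add]
        ring_nf
      have h2 : Real.exp (-s) * Real.exp s = 1 := by rw [← Real.exp_add]; simp
      simp only [c, this, neg_neg]
      linear_combination (Real.exp s * Real.exp (-2 * a) *
            ((sampledMean Φ h 0 (-y) - sampledMean Φ h 0 y) / 2)) * h2
    simp_rw [h1]
    rw [intervalIntegral.integral_sub (Continuous.intervalIntegrable (by fun_prop) _ _)
      (Continuous.intervalIntegrable (by fun_prop) _ _), intervalIntegral.integral_mul_const,
      intervalIntegral.integral_mul_const, integral_exp]
    have h2 : ∫ s in 0..a, Real.exp (-s) = 1 - Real.exp (-a) := by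
      simp [intervalIntegral.integral_comp_neg (fun x => Real.exp x)]
    have h3 : Real.exp a * Real.exp (-2 * a) = Real.exp (-a) := by
      rw [← Real.exp_add]
      ring_nf
    rw [h2, Real.exp_zero]
    simp only [c]
    linear_combination ((sampledMean Φ h 0 y - sampledMean Φ h 0 (-y)) / 2) * h3
  have := renewal_unique (C := C + (C + C)) (d := fun a y => sampledMean Φ h a y - c a y)
    (fun a y ha => by
      have h0 := hexp a ha
      have h1 := Real.exp_pos (-2 * a)
      refine (abs_sub _ _).trans (add_le_add (abs_sampledMean_le hC _ _ _) ?_)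
      refine (abs_add_le _ _).trans (add_le_add ?_ ?_) <;> rw [abs_mul] <;>
        refine (mul_le_of_le_one_left (abs_nonneg _) ?_).trans (abs_sampledMean_le hC _ _ _) <;>
        rw [abs_le] <;> constructor <;> linarith)
    (fun a y ha => by
      rw [sampledMean_renewal hΦ hC h hh ha y, hc a y ha, add_sub_add_right_eq_sub,
        ← intervalIntegral.integral_sub]
      · simp only [mul_sub]
      · rw [intervalIntegrable_iff_integrableOn_Ioc_of_le ha]
        exact (integrableOn_exp_neg_mul (K := fun s => sampledMean Φ h (a - s) (-y))
          ((measurable_sampledMean hΦ h (-y)).comp (measurable_const.sub measurable_id))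
          (fun s => abs_sampledMean_le hC _ _ _)).mono_set Set.Ioc_subset_Ioi_self
      · exact Continuous.intervalIntegrable (by fun_prop) _ _) ha y
  exact sub_eq_zero.1 this

end Markov

/-! ### The sampled walk as a nearest-neighbour Ising chain. -/

section Grid

lemma measurableSet_parity_eq (y t s : ℝ) : MeasurableSet {w | y * parity w t = s} :=
  measurableSet_eq_fun ((measurable_parity t).const_mul y) measurable_const

lemma units_eq_neg_iff (a b : ℤˣ) : a = -b ↔ ¬ a = b := by
  revert a b
  decide

/-- The law of the walk on the grid `0, h, 2h, …, Kh`. -/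
lemma waitLaw_grid {h : ℝ} (hh : 0 ≤ h) (K : ℕ) (y : ℤˣ) (σ : Fin (K + 1) → ℤˣ) :
    waitLaw.real {w | ∀ i : Fin (K + 1), ((y : ℤ) : ℝ) * parity w (i * h) = ((σ i : ℤ) : ℝ)}
      = (if σ 0 = y then 1 else 0) *
        ∏ i : Fin K, (1 + Real.exp (-2 * h) * spinProd σ i.castSucc i.succ) / 2 := by
  -- The starting sign has to vary: the Markov property at time `h` involves both `y` and `-y`.
  induction K generalizing y with
  | zero =>
    have h1 : {w | ∀ i : Fin 1, ((y : ℤ) : ℝ) * parity w (i * h) = ((σ i : ℤ) : ℝ)}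
        =ᵐ[waitLaw] {_w | σ 0 = y} := by
      filter_upwards [ae_regular] with w hw
      refine propext ?_
      change (∀ i : Fin 1, _) ↔ σ 0 = y
      simp [Fin.forall_fin_one, hw.parity_zero, eq_comm, Units.ext_iff]
    rw [measureReal_congr h1]
    by_cases hy : σ 0 = y <;> simp [hy]
  | succ K ih =>
    let Φ : (ℕ → ℝ) → ℝ :=
      {x : ℕ → ℝ | ∀ i : Fin (K + 1), x i = ((σ i.succ : ℤ) : ℝ)}.indicator 1
    have hS : MeasurableSet {x : ℕ → ℝ | ∀ i : Fin (K + 1), x i = ((σ i.succ : ℤ) : ℝ)} := by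
      simp only [Set.ofPred_forall]
      exact .iInter fun i => measurableSet_eq_fun (measurable_pi_apply _) measurable_const
    have hΦ : Measurable Φ := measurable_one.indicator hS
    have hC : ∀ x, |Φ x| ≤ 1 := fun x => by
      by_cases hx : x ∈ {x : ℕ → ℝ | ∀ i : Fin (K + 1), x i = ((σ i.succ : ℤ) : ℝ)}
      · simp [Φ, Set.indicator_of_mem hx]
      · simp [Φ, Set.indicator_of_notMem hx]
    have hmean : ∀ a z, sampledMean Φ h a z = waitLaw.real
        {w | ∀ i : Fin (K + 1), z * parity w (a + i * h) = ((σ i.succ : ℤ) : ℝ)} := by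
      intro a z
      rw [← integral_indicator_one]
      · rfl
      · simp only [Set.ofPred_forall]
        exact .iInter fun i => measurableSet_parity_eq _ _ _
    have hmarkov := sampledMean_markov hΦ hC hh hh ((y : ℤ) : ℝ)
    have hneg : -((y : ℤ) : ℝ) = (((-y : ℤˣ) : ℤ) : ℝ) := by push_cast; rfl
    have ih1 := ih y (fun i => σ i.succ)
    have ih2 := ih (-y) (fun i => σ i.succ)
    rw [hneg, hmean 0, hmean 0] at hmarkov
    simp only [zero_add] at hmarkov
    rw [ih1, ih2, hmean] at hmarkov
    rw [Fin.prod_univ_succ]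
    by_cases hy : σ 0 = y
    · have h1 : {w | ∀ i : Fin (K + 2), ((y : ℤ) : ℝ) * parity w (i * h) = ((σ i : ℤ) : ℝ)}
          =ᵐ[waitLaw] {w | ∀ i : Fin (K + 1),
            ((y : ℤ) : ℝ) * parity w (h + i * h) = ((σ i.succ : ℤ) : ℝ)} := by
        filter_upwards [ae_regular] with w hw
        refine propext ?_
        change (∀ i : Fin (K + 2), _) ↔ (∀ i : Fin (K + 1), _)
        rw [Fin.forall_fin_succ]
        have : ∀ i : Fin (K + 1), (((i.succ : Fin (K + 2)) : ℕ) : ℝ) * h = h + (i : ℕ) * h := by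
          intro i
          push_cast [Fin.val_succ]
          ring
        simp only [this]
        simp [hw.parity_zero, hy]
      rw [measureReal_congr h1, hmarkov, if_pos hy, spinProd_eq_ite]
      subst hy
      simp only [units_eq_neg_iff, Fin.castSucc_zero, eq_comm (a := σ 0)]
      simp only [spinProd, Fin.succ_castSucc]
      split_ifs <;> ring
    · have h1 : {w | ∀ i : Fin (K + 2), ((y : ℤ) : ℝ) * parity w (i * h) = ((σ i : ℤ) : ℝ)}
          =ᵐ[waitLaw] (∅ : Set (ℕ → ℝ)) := by
        filter_upwards [ae_regular] with w hw
        refine propext ⟨fun hx => hy ?_, fun hx => hx.elim⟩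
        have := hx 0
        simpa [hw.parity_zero, Units.ext_iff, eq_comm] using this
      rw [measureReal_congr h1, if_neg hy]
      simp

/-- The spins of the walk started in `1` at the grid points `0, h, …, Kh`. -/
def gridSpin (K : ℕ) (h : ℝ) (w : ℕ → ℝ) (i : Fin (K + 1)) : ℤˣ := (-1) ^ jumpCount w (i * h)

lemma coe_gridSpin (K : ℕ) (h : ℝ) (w : ℕ → ℝ) (i : Fin (K + 1)) :
    ((gridSpin K h w i : ℤ) : ℝ) = parity w (i * h) := by
  simp [gridSpin, parity]

lemma gridSpin_eq_iff (K : ℕ) (h : ℝ) (w : ℕ → ℝ) (σ : Fin (K + 1) → ℤˣ) :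
    gridSpin K h w = σ ↔ ∀ i : Fin (K + 1), parity w (i * h) = ((σ i : ℤ) : ℝ) := by
  simp only [funext_iff, ← coe_gridSpin]
  exact forall_congr' fun i => by rw [Int.cast_inj, Units.ext_iff]

/-- The Ising weight of the nearest neighbour chain. -/
def chainWeight (K : ℕ) (h : ℝ) (σ : Fin (K + 1) → ℤˣ) : ℝ :=
  ∏ i : Fin K, (1 + Real.exp (-2 * h) * spinProd σ i.castSucc i.succ) / 2

lemma integral_gridSpin {h : ℝ} (hh : 0 ≤ h) (K : ℕ) (F : (Fin (K + 1) → ℤˣ) → ℝ) :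
    ∫ w, F (gridSpin K h w) ∂waitLaw
      = ∑ σ, (if σ 0 = 1 then 1 else 0) * (F σ * chainWeight K h σ) := by
  have hm : ∀ σ : Fin (K + 1) → ℤˣ, MeasurableSet {w | gridSpin K h w = σ} := fun σ => by
    simp only [gridSpin_eq_iff, Set.ofPred_forall]
    exact .iInter fun i => measurableSet_eq_fun (measurable_parity _) measurable_const
  have h1 : ∀ w, F (gridSpin K h w)
      = ∑ σ, {w | gridSpin K h w = σ}.indicator (fun _ => F σ) w := fun w => by
    rw [Finset.sum_eq_single (gridSpin K h w)]
    · exact (Set.indicator_of_mem (s := {w' | gridSpin K h w' = gridSpin K h w}) (a := w) rfl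
        fun _ => F (gridSpin K h w)).symm
    · intro σ _ hσ
      exact Set.indicator_of_notMem (fun hx => hσ (Eq.symm hx)) _
    · exact fun hx => absurd (Finset.mem_univ _) hx
  simp_rw [h1]
  rw [integral_finsetSum _ fun σ _ => (integrable_const _).indicator (hm σ)]
  refine Finset.sum_congr rfl fun σ _ => ?_
  rw [integral_indicator_const _ (hm σ)]
  have := waitLaw_grid hh K 1 σ
  simp only [Units.val_one, Int.cast_one, one_mul, ← gridSpin_eq_iff] at this
  rw [this, chainWeight, smul_eq_mul]
  ring

end Grid

/-! ### The two-point function as a ratio of integrals over waiting times. -/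

section Reduction

/-- The bond intensity restricted to the square `[0, T]²`. -/
def boxIntensity (g : ℝ → ℝ) (α T : ℝ) : Measure (ℝ × ℝ) :=
  (bondIntensity g α).restrict (Set.Icc 0 T ×ˢ Set.Icc 0 T)

/-- The interaction energy of the walk started in `1`, for the pair intensity `β`, where the walk
is read off at the times given by `u`. -/
def action (β : Measure (ℝ × ℝ)) (u : ℝ → ℝ) (w : ℕ → ℝ) : ℝ :=
  ∫ p, parity w (u p.1) * parity w (u p.2) ∂β

lemma measurableSet_box (T : ℝ) : MeasurableSet (Set.Icc (0 : ℝ) T ×ˢ Set.Icc (0 : ℝ) T) :=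
  measurableSet_Icc.prod measurableSet_Icc

lemma boxIntensity_eq (g : ℝ → ℝ) (α T : ℝ) : boxIntensity g α T =
    (volume.restrict ((Set.Icc (0 : ℝ) T ×ˢ Set.Icc (0 : ℝ) T) ∩ {p | p.1 < p.2})).withDensity
      fun p => ENNReal.ofReal (2 * α * g (p.2 - p.1)) := by
  rw [boxIntensity, bondIntensity, restrict_withDensity (measurableSet_box T),
    Measure.restrict_restrict (measurableSet_box T)]
  congr 2
  ext p
  simp only [Set.mem_inter_iff, Set.mem_prod, Set.mem_Icc, Set.mem_ofPred_eq]
  tauto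

lemma isFiniteMeasure_boxIntensity {g : ℝ → ℝ} (hg : Continuous g) (α T : ℝ) :
    IsFiniteMeasure (boxIntensity g α T) := by
  rw [boxIntensity_eq]
  refine isFiniteMeasure_withDensity_ofReal (Integrable.hasFiniteIntegral ?_)
  refine IntegrableOn.mono_set ?_ Set.inter_subset_left
  exact ContinuousOn.integrableOn_compact (isCompact_Icc.prod isCompact_Icc)
    (by fun_prop)

lemma boxIntensity_mono (g : ℝ → ℝ) (α : ℝ) {T T' : ℝ} (h : T ≤ T') :
    boxIntensity g α T ≤ boxIntensity g α T' :=
  Measure.restrict_mono (Set.prod_mono (Set.Icc_subset_Icc_right h) (Set.Icc_subset_Icc_right h))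
    le_rfl

lemma volume_diagonal : volume {p : ℝ × ℝ | p.1 = p.2} = 0 := by
  rw [Measure.volume_eq_prod,
    Measure.measure_prod_null (measurableSet_eq_fun measurable_fst measurable_snd)]
  refine Eventually.of_forall fun x => ?_
  have : (Prod.mk x ⁻¹' {p : ℝ × ℝ | p.1 = p.2}) = {x} := by ext; simp [eq_comm]
  change volume (Prod.mk x ⁻¹' {p : ℝ × ℝ | p.1 = p.2}) = 0
  rw [this, Real.volume_singleton]

/-- Reflection in the diagonal, a null set, maps one half of the square to the other, and evenness
of `g` preserves the integrand. The factor 2 in the bond intensity thus makes up for its restriction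
to `s < t`, and the Ising energy is an integral against that intensity. -/
lemma integral_boxIntensity {g : ℝ → ℝ} (hg : Continuous g) (hg_even : ∀ t, g (-t) = g t)
    (hg_nonneg : ∀ t, 0 ≤ g t) {α : ℝ} (hα : 0 ≤ α) (T : ℝ) {f : ℝ × ℝ → ℝ} (hf : Measurable f)
    (hf1 : ∀ p, |f p| ≤ 1) (hsymm : ∀ p, f p.swap = f p) :
    ∫ p, f p ∂(boxIntensity g α T)
      = α * ∫ p in Set.Icc (0 : ℝ) T ×ˢ Set.Icc (0 : ℝ) T, g (p.2 - p.1) * f p := by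
  have hwm : MeasurableSet {p : ℝ × ℝ | p.1 < p.2} := measurableSet_lt measurable_fst measurable_snd
  have hwm' : MeasurableSet {p : ℝ × ℝ | p.2 < p.1} :=
    measurableSet_lt measurable_snd measurable_fst
  have hm : Measurable fun p : ℝ × ℝ => g (p.2 - p.1) :=
    (hg.comp (continuous_snd.sub continuous_fst)).measurable
  have hint : IntegrableOn (fun p : ℝ × ℝ => g (p.2 - p.1) * f p)
      (Set.Icc (0 : ℝ) T ×ˢ Set.Icc (0 : ℝ) T) :=
    Integrable.mul_bdd (c := 1)
      (ContinuousOn.integrableOn_compact (isCompact_Icc.prod isCompact_Icc) (by fun_prop))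
      hf.aestronglyMeasurable (Eventually.of_forall hf1)
  rw [boxIntensity_eq, integral_withDensity_eq_integral_toReal_smul (by fun_prop)
    (Eventually.of_forall fun p => ENNReal.ofReal_lt_top)]
  have h1 : ∀ p : ℝ × ℝ, (ENNReal.ofReal (2 * α * g (p.2 - p.1))).toReal • f p
      = 2 * α * (g (p.2 - p.1) * f p) := fun p => by
    have := hg_nonneg (p.2 - p.1)
    rw [ENNReal.toReal_ofReal (by positivity), smul_eq_mul, mul_assoc]
  simp_rw [h1]
  rw [integral_const_mul]
  have hswap : ∫ p in (Set.Icc (0 : ℝ) T ×ˢ Set.Icc (0 : ℝ) T) ∩ {p | p.2 < p.1},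
      g (p.2 - p.1) * f p = ∫ p in (Set.Icc (0 : ℝ) T ×ˢ Set.Icc (0 : ℝ) T) ∩ {p | p.1 < p.2},
      g (p.2 - p.1) * f p := by
    have hmp : MeasurePreserving (Prod.swap : ℝ × ℝ → ℝ × ℝ) volume volume :=
      Measure.measurePreserving_swap
    rw [← hmp.setIntegral_preimage_emb MeasurableEquiv.prodComm.measurableEmbedding]
    have : Prod.swap ⁻¹' ((Set.Icc (0 : ℝ) T ×ˢ Set.Icc (0 : ℝ) T) ∩ {p : ℝ × ℝ | p.2 < p.1})
        = (Set.Icc (0 : ℝ) T ×ˢ Set.Icc (0 : ℝ) T) ∩ {p | p.1 < p.2} := by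
      ext p
      simp only [Set.mem_preimage, Set.mem_inter_iff, Set.mem_prod, Prod.fst_swap, Prod.snd_swap,
        Set.mem_ofPred_eq]
      tauto
    rw [this]
    refine setIntegral_congr_fun ((measurableSet_box T).inter hwm) fun p _ => ?_
    simp only [Prod.fst_swap, Prod.snd_swap, hsymm]
    rw [← hg_even, neg_sub]
  have hsplit : ∫ p in Set.Icc (0 : ℝ) T ×ˢ Set.Icc (0 : ℝ) T, g (p.2 - p.1) * f p
      = (∫ p in (Set.Icc (0 : ℝ) T ×ˢ Set.Icc (0 : ℝ) T) ∩ {p | p.1 < p.2}, g (p.2 - p.1) * f p)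
        + ∫ p in (Set.Icc (0 : ℝ) T ×ˢ Set.Icc (0 : ℝ) T) ∩ {p | p.2 < p.1},
          g (p.2 - p.1) * f p := by
    rw [← setIntegral_union _ ((measurableSet_box T).inter hwm')
      (hint.mono_set Set.inter_subset_left) (hint.mono_set Set.inter_subset_left)]
    · refine setIntegral_congr_set ?_
      have h0 : ∀ᵐ p : ℝ × ℝ, p.1 ≠ p.2 := by
        rw [ae_iff]
        simpa using volume_diagonal
      filter_upwards [h0] with p hp
      refine propext (a := p ∈ (_ : Set (ℝ × ℝ))) (b := p ∈ (_ : Set (ℝ × ℝ))) ?_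
      have : p.1 < p.2 ∨ p.2 < p.1 := lt_or_gt_of_ne hp
      simp only [Set.mem_inter_iff, Set.mem_ofPred_eq]
      rw [← and_or_left]
      exact (and_iff_left this).symm
    · rw [Set.disjoint_left]
      intro p hp hp'
      exact lt_asymm (show p.1 < p.2 from hp.2) hp'.2
  rw [hsplit, hswap]
  ring

lemma measurable_parity_time (w : ℕ → ℝ) : Measurable (parity w) := by
  have : Measurable fun t : ℝ => (w, t) := measurable_prodMk_left
  simpa only [Function.comp_def] using measurable_parity_uncurry.comp this

lemma measurable_parity_mul_parity (w : ℕ → ℝ) {u : ℝ → ℝ} (hu : Measurable u) :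
    Measurable fun p : ℝ × ℝ => parity w (u p.1) * parity w (u p.2) :=
  ((measurable_parity_time w).comp (hu.comp measurable_fst)).mul
    ((measurable_parity_time w).comp (hu.comp measurable_snd))

lemma abs_parity_mul (w : ℕ → ℝ) (s t : ℝ) : |parity w s * parity w t| = 1 := by
  rw [abs_mul, abs_parity, abs_parity, one_mul]

lemma measurable_action (β : Measure (ℝ × ℝ)) [SFinite β] {u : ℝ → ℝ} (hu : Measurable u) :
    Measurable (action β u) := by
  have h1 : Measurable fun p : (ℕ → ℝ) × (ℝ × ℝ) => parity p.1 (u p.2.1) := by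
    have : Measurable fun p : (ℕ → ℝ) × (ℝ × ℝ) => (p.1, u p.2.1) := by fun_prop
    simpa only [Function.comp_def] using measurable_parity_uncurry.comp this
  have h2 : Measurable fun p : (ℕ → ℝ) × (ℝ × ℝ) => parity p.1 (u p.2.2) := by
    have : Measurable fun p : (ℕ → ℝ) × (ℝ × ℝ) => (p.1, u p.2.2) := by fun_prop
    simpa only [Function.comp_def] using measurable_parity_uncurry.comp this
  exact ((h1.mul h2).stronglyMeasurable.integral_prod_right' (ν := β)).measurable

lemma exp_action_le (β : Measure (ℝ × ℝ)) [IsFiniteMeasure β] (u : ℝ → ℝ) (w : ℕ → ℝ) :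
    |Real.exp (action β u w)| ≤ Real.exp (β.real Set.univ) := by
  have := norm_integral_le_of_norm_le_const (μ := β)
    (f := fun p : ℝ × ℝ => parity w (u p.1) * parity w (u p.2)) (C := 1)
    (Eventually.of_forall fun p => (abs_parity_mul w (u p.1) (u p.2)).le)
  rw [one_mul] at this
  rw [abs_of_pos (Real.exp_pos _)]
  exact Real.exp_le_exp.2 ((le_abs_self _).trans this)

lemma integral_exp_action_pos (β : Measure (ℝ × ℝ)) [IsFiniteMeasure β] {u : ℝ → ℝ}
    (hu : Measurable u) : 0 < ∫ w, Real.exp (action β u w) ∂waitLaw :=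
  integral_exp_pos (Integrable.of_bound
    (Real.measurable_exp.comp (measurable_action β hu)).aestronglyMeasurable
    (Real.exp (β.real Set.univ)) (Eventually.of_forall fun w => exp_action_le β u w))

lemma walkLaw_eq : walkLaw = (2⁻¹ : ℝ≥0∞) • waitLaw.map (Prod.mk (1 : ℝ))
    + (2⁻¹ : ℝ≥0∞) • waitLaw.map (Prod.mk (-1 : ℝ)) := by
  rw [walkLaw, Measure.add_prod, Measure.prod_smul_left, Measure.prod_smul_left,
    Measure.dirac_prod, Measure.dirac_prod]
  rfl

lemma ae_walkLaw {p : PathSpace → Prop} (h1 : ∀ᵐ w ∂waitLaw, p (1, w))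
    (h2 : ∀ᵐ w ∂waitLaw, p (-1, w)) (hp : MeasurableSet {ω | p ω}) : ∀ᵐ ω ∂walkLaw, p ω := by
  rw [walkLaw_eq, ae_add_measure_iff]
  constructor <;> refine Measure.ae_smul_measure ?_ _ <;>
    rwa [ae_map_iff measurable_prodMk_left.aemeasurable hp]

lemma measurable_spin (t : ℝ) : Measurable (spin t) := by
  have : Measurable fun ω : PathSpace => ω.1 * parity ω.2 t :=
    measurable_fst.mul ((measurable_parity t).comp measurable_snd)
  simpa only [← spin_eq] using this

lemma setIntegral_walkLaw {F : PathSpace → ℝ} (hF : Measurable F) {C : ℝ} (hC : ∀ ω, |F ω| ≤ C) :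
    ∫ ω in {ω | spin 0 ω = 1}, F ω ∂walkLaw = 2⁻¹ * ∫ w, F (1, w) ∂waitLaw := by
  have hs : MeasurableSet {ω | spin 0 ω = 1} := measurableSet_eq_fun (measurable_spin 0)
    measurable_const
  have hm := hF.indicator hs
  have hb : ∀ ω, ‖{ω | spin 0 ω = 1}.indicator F ω‖ ≤ C := fun ω =>
    (norm_indicator_le_norm_self F ω).trans (hC ω)
  have hi : ∀ x : ℝ, Integrable ({ω | spin 0 ω = 1}.indicator F) (waitLaw.map (Prod.mk x)) := by
    intro x
    have : IsProbabilityMeasure (waitLaw.map (Prod.mk x)) :=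
      Measure.isProbabilityMeasure_map measurable_prodMk_left.aemeasurable
    exact Integrable.of_bound hm.aestronglyMeasurable C (Eventually.of_forall hb)
  rw [← integral_indicator hs, walkLaw_eq, integral_add_measure
    ((hi 1).smul_measure (by simp)) ((hi (-1)).smul_measure (by simp)), integral_smul_measure,
    integral_smul_measure, integral_map measurable_prodMk_left.aemeasurable
    hm.aestronglyMeasurable, integral_map measurable_prodMk_left.aemeasurable
    hm.aestronglyMeasurable]
  have h1 : ∫ w, {ω | spin 0 ω = 1}.indicator F (1, w) ∂waitLaw = ∫ w, F (1, w) ∂waitLaw := by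
    refine integral_congr_ae ?_
    filter_upwards [ae_regular] with w hw
    exact Set.indicator_of_mem (by simp [spin_eq, hw.parity_zero]) _
  have h2 : ∫ w, {ω | spin 0 ω = 1}.indicator F (-1, w) ∂waitLaw = 0 := by
    rw [← integral_zero (ℕ → ℝ) ℝ (μ := waitLaw)]
    refine integral_congr_ae ?_
    filter_upwards [ae_regular] with w hw
    refine Set.indicator_of_notMem ?_ _
    simp only [spin_eq, Set.mem_ofPred_eq]
    norm_num [hw.parity_zero]
  rw [h1, h2]
  simp

instance : IsProbabilityMeasure walkLaw := by
  refine ⟨?_⟩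
  have h : ∀ x : ℝ, (waitLaw.map (Prod.mk x)) Set.univ = 1 := fun x => by
    rw [Measure.map_apply measurable_prodMk_left .univ]
    simp
  rw [walkLaw_eq, Measure.add_apply, Measure.smul_apply, Measure.smul_apply, h, h]
  simp [ENNReal.inv_two_add_inv_two]

/-- The normalizing constant and the mass 1/2 of the starting spin cancel in the conditional
expectation, and the global sign drops out of the quadratic energy. -/
lemma twoPointT_eq {g : ℝ → ℝ} (hg : Continuous g) (hg_even : ∀ t, g (-t) = g t)
    (hg_nonneg : ∀ t, 0 ≤ g t) {α : ℝ} (hα : 0 ≤ α) (T t : ℝ) :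
    twoPointT g α T t = (∫ w, parity w t * Real.exp (action (boxIntensity g α T) id w) ∂waitLaw)
      / ∫ w, Real.exp (action (boxIntensity g α T) id w) ∂waitLaw := by
  have hfin := isFiniteMeasure_boxIntensity hg α T
  set β := boxIntensity g α T with hβ
  have hs : MeasurableSet {ω | spin 0 ω = 1} := measurableSet_eq_fun (measurable_spin 0)
    measurable_const
  have hact : ∀ ω : PathSpace, (α * ∫ p in Set.Icc (0 : ℝ) T ×ˢ Set.Icc (0 : ℝ) T,
      g (p.2 - p.1) * (spin p.1 ω * spin p.2 ω)) = ω.1 * ω.1 * action β id ω.2 := by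
    intro ω
    have h1 := integral_boxIntensity hg hg_even hg_nonneg hα T (measurable_parity_mul_parity ω.2 measurable_id)
      (fun p => (abs_parity_mul ω.2 p.1 p.2).le) (fun p => by simp [mul_comm])
    simp only [id] at h1
    simp only [action, id]
    rw [h1, mul_left_comm, ← integral_const_mul (ω.1 * ω.1)]
    congr 2
    funext p
    rw [spin_eq, spin_eq]
    ring
  -- The starting spin is an arbitrary real number in `PathSpace`; its square is 1 only almost
  -- everywhere.
  have hact' : (fun ω : PathSpace => ω.1 * ω.1 * action β id ω.2) =ᵐ[walkLaw]
      fun ω => action β id ω.2 := by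
    have h1 : Measurable fun ω : PathSpace => action β id ω.2 :=
      (measurable_action β measurable_id).comp measurable_snd
    refine ae_walkLaw (by simp) (by simp) (measurableSet_eq_fun ?_ h1)
    exact (measurable_fst.mul measurable_fst).mul h1
  have hme : Measurable fun ω : PathSpace => Real.exp (action β id ω.2) :=
    Real.measurable_exp.comp ((measurable_action β measurable_id).comp measurable_snd)
  have hbe : ∀ ω : PathSpace, |Real.exp (action β id ω.2)| ≤ Real.exp (β.real Set.univ) := fun ω =>
    exp_action_le β id ω.2
  have hie : Integrable (fun ω : PathSpace => Real.exp (action β id ω.2)) walkLaw :=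
    Integrable.of_bound hme.aestronglyMeasurable _ (Eventually.of_forall hbe)
  have hZ : 0 < ∫ ω : PathSpace, Real.exp (action β id ω.2) ∂walkLaw := integral_exp_pos hie
  rw [twoPointT, isingMeasure]
  simp_rw [hact]
  rw [tilted_congr hact', ProbabilityTheory.cond, integral_smul_measure, setIntegral_tilted' _ _ hs,
    tilted_apply_eq_ofReal_integral' _ hs]
  simp only [div_eq_mul_inv, smul_eq_mul]
  have h1 : ∀ ω : PathSpace, Real.exp (action β id ω.2)
      * (∫ ω, Real.exp (action β id ω.2) ∂walkLaw)⁻¹ * spin t ω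
      = (∫ ω, Real.exp (action β id ω.2) ∂walkLaw)⁻¹ *
        (spin t ω * Real.exp (action β id ω.2)) := fun ω => by ring
  simp_rw [h1]
  rw [integral_mul_const, integral_const_mul, setIntegral_walkLaw hme hbe]
  have h2 : ∫ ω in {ω | spin 0 ω = 1}, spin t ω * Real.exp (action β id ω.2) ∂walkLaw
      = 2⁻¹ * ∫ w, parity w t * Real.exp (action β id w) ∂waitLaw := by
    have hF : Measurable fun ω : PathSpace => parity ω.2 t * Real.exp (action β id ω.2) :=
      ((measurable_parity t).comp measurable_snd).mul hme
    rw [← setIntegral_walkLaw hF (C := Real.exp (β.real Set.univ)) fun ω => by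
      rw [abs_mul, abs_parity, one_mul]; exact hbe ω]
    refine setIntegral_congr_ae hs ?_
    refine ae_walkLaw ?_ ?_ ?_
    · refine Eventually.of_forall fun w _ => ?_
      simp [spin_eq]
    · filter_upwards [ae_regular] with w hw h
      simp only [spin_eq, hw.parity_zero] at h
      norm_num at h
    · exact hs.imp (measurableSet_eq_fun ((measurable_spin t).mul hme) hF)
  rw [h2, ENNReal.toReal_inv, ENNReal.toReal_ofReal]
  · have h3 := integral_exp_action_pos β measurable_id
    field_simp
  · have : 0 ≤ ∫ w, Real.exp (action β id w) ∂waitLaw := integral_nonneg fun w => (Real.exp_pos _).le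
    positivity

end Reduction

/-! ### Approximation by Ising models on a grid. -/

section Discretisation

set_option linter.unusedSectionVars false

/-- The smallest multiple of `1 / m` that is at least `s`. -/
def gridUp (m : ℕ) (s : ℝ) : ℝ := ⌈(m : ℝ) * s⌉₊ * (m : ℝ)⁻¹

lemma measurable_gridUp (m : ℕ) : Measurable (gridUp m) := by
  unfold gridUp
  exact ((measurable_from_top (f := fun k : ℕ => (k : ℝ))).comp
    (Nat.measurable_ceil.comp (measurable_const_mul _))).mul_const _

lemma le_gridUp {m : ℕ} (hm : 0 < m) (s : ℝ) : s ≤ gridUp m s := by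
  have h : (0 : ℝ) < m := Nat.cast_pos.2 hm
  rw [gridUp, ← div_eq_mul_inv, le_div_iff₀ h, mul_comm]
  exact Nat.le_ceil _

lemma gridUp_lt {m : ℕ} (hm : 0 < m) {s : ℝ} (hs : 0 ≤ s) : gridUp m s < s + (m : ℝ)⁻¹ := by
  have h : (0 : ℝ) < m := Nat.cast_pos.2 hm
  have := Nat.ceil_lt_add_one (show 0 ≤ (m : ℝ) * s by positivity)
  rw [gridUp, ← div_eq_mul_inv, div_lt_iff₀ h, add_mul, inv_mul_cancel₀ h.ne']
  linarith

lemma tendsto_gridUp {s : ℝ} (hs : 0 ≤ s) :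
    Tendsto (fun m => gridUp m s) atTop (𝓝[≥] s) := by
  refine tendsto_nhdsWithin_iff.2 ⟨?_, ?_⟩
  · refine tendsto_of_tendsto_of_tendsto_of_le_of_le' tendsto_const_nhds
      (g := fun _ => s) (h := fun m : ℕ => s + (m : ℝ)⁻¹) ?_ ?_ ?_
    · simpa using (tendsto_inv_atTop_nhds_zero_nat (𝕜 := ℝ)).const_add s
    · filter_upwards [eventually_gt_atTop 0] with m hm using le_gridUp hm s
    · filter_upwards [eventually_gt_atTop 0] with m hm using (gridUp_lt hm hs).le
  · filter_upwards [eventually_gt_atTop 0] with m hm using le_gridUp hm s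

variable {β : Measure (ℝ × ℝ)} [IsFiniteMeasure β]

/-- Times are rounded up, so right-continuity makes the integrand eventually constant at each
nonnegative pair of times. -/
lemma tendsto_action_gridUp (hβ : ∀ᵐ p ∂β, 0 ≤ p.1 ∧ 0 ≤ p.2) {w : ℕ → ℝ} (hw : Regular w) :
    Tendsto (fun m => action β (gridUp m) w) atTop (𝓝 (action β id w)) := by
  refine tendsto_integral_of_dominated_convergence (fun _ => 1)
    (fun m => (measurable_parity_mul_parity w (measurable_gridUp m)).aestronglyMeasurable)
    (integrable_const _)
    (fun m => Eventually.of_forall fun p => (abs_parity_mul w _ _).le) ?_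
  filter_upwards [hβ] with p hp
  refine tendsto_const_nhds.congr' ?_
  filter_upwards [(tendsto_gridUp hp.1).eventually (hw.eventually_parity_eq p.1),
    (tendsto_gridUp hp.2).eventually (hw.eventually_parity_eq p.2)] with m h1 h2
  rw [h1, h2]
  rfl

lemma tendsto_integral_exp_action {f : (ℕ → ℝ) → ℝ} (hf : Measurable f) (hf1 : ∀ w, |f w| ≤ 1)
    (hβ : ∀ᵐ p ∂β, 0 ≤ p.1 ∧ 0 ≤ p.2) :
    Tendsto (fun m => ∫ w, f w * Real.exp (action β (gridUp m) w) ∂waitLaw) atTop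
      (𝓝 (∫ w, f w * Real.exp (action β id w) ∂waitLaw)) := by
  refine tendsto_integral_of_dominated_convergence (fun _ => Real.exp (β.real Set.univ))
    (fun m => (hf.mul (Real.measurable_exp.comp
      (measurable_action β (measurable_gridUp m)))).aestronglyMeasurable)
    (integrable_const _) (fun m => Eventually.of_forall fun w => ?_) ?_
  · rw [norm_mul]
    exact (mul_le_of_le_one_left (norm_nonneg _) (hf1 w)).trans (exp_action_le β _ w)
  · filter_upwards [ae_regular] with w hw
    exact ((Real.continuous_exp.tendsto _).comp (tendsto_action_gridUp hβ hw)).const_mul _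

/-- The points of the line that are rounded up to the grid point with index `i`. -/
def gridCell (m i : ℕ) : Set ℝ := {s | ⌈(m : ℝ) * s⌉₊ = i}

lemma measurableSet_gridCell (m i : ℕ) : MeasurableSet (gridCell m i) :=
  (Nat.measurable_ceil.comp (measurable_const_mul (m : ℝ))) (measurableSet_singleton i)

/-- The endpoints of the edges of the graph on the grid: nearest neighbour edges, and long edges
indexed by all pairs of grid points. -/
def gridEnds (K : ℕ) : Fin K ⊕ Fin (K + 1) × Fin (K + 1) → Fin (K + 1) × Fin (K + 1) :=
  Sum.elim (fun i => (i.castSucc, i.succ)) id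

/-- The intensity of the bonds that join the grid cells `i` and `j`. -/
def gridCoupling (β : Measure (ℝ × ℝ)) (m : ℕ) {K : ℕ} (e : Fin (K + 1) × Fin (K + 1)) : ℝ :=
  β.real (gridCell m e.1 ×ˢ gridCell m e.2)

/-- The edge weights of the Ising model on the grid. -/
def gridEdgeWeight (β : Measure (ℝ × ℝ)) (m K : ℕ) : Fin K ⊕ Fin (K + 1) × Fin (K + 1) → ℝ :=
  Sum.elim (fun _ => 2 * Real.exp (-2 * (m : ℝ)⁻¹) / (1 - Real.exp (-2 * (m : ℝ)⁻¹)))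
    fun e => Real.exp (2 * gridCoupling β m e) - 1

lemma action_gridUp_eq {m K : ℕ} (hβ : ∀ᵐ p ∂β, (m : ℝ) * p.1 ≤ K ∧ (m : ℝ) * p.2 ≤ K)
    (w : ℕ → ℝ) : action β (gridUp m) w
      = ∑ e : Fin (K + 1) × Fin (K + 1),
        gridCoupling β m e * spinProd (gridSpin K (m : ℝ)⁻¹ w) e.1 e.2 := by
  have hms : ∀ e : Fin (K + 1) × Fin (K + 1),
      MeasurableSet (gridCell m e.1 ×ˢ gridCell m e.2) := fun e =>
    (measurableSet_gridCell m _).prod (measurableSet_gridCell m _)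
  have h : ∀ᵐ p ∂β, parity w (gridUp m p.1) * parity w (gridUp m p.2)
      = ∑ e : Fin (K + 1) × Fin (K + 1), (gridCell m e.1 ×ˢ gridCell m e.2).indicator
        (fun _ => spinProd (gridSpin K (m : ℝ)⁻¹ w) e.1 e.2) p := by
    filter_upwards [hβ] with p hp
    have hK : ∀ s : ℝ, (m : ℝ) * s ≤ K → ⌈(m : ℝ) * s⌉₊ < K + 1 := fun s hs =>
      Nat.lt_succ_of_le (Nat.ceil_le.2 hs)
    rw [Finset.sum_eq_single (⟨⟨_, hK _ hp.1⟩, ⟨_, hK _ hp.2⟩⟩ : Fin (K + 1) × Fin (K + 1))]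
    · rw [Set.indicator_of_mem (show p ∈ gridCell m ⌈(m : ℝ) * p.1⌉₊ ×ˢ gridCell m ⌈(m : ℝ) * p.2⌉₊
        from ⟨rfl, rfl⟩)]
      simp only [spinProd, Units.val_mul, Int.cast_mul, coe_gridSpin, gridUp]
    · intro e _ he
      refine Set.indicator_of_notMem (fun hx => he ?_) _
      exact Prod.ext (Fin.ext (Eq.symm hx.1)) (Fin.ext (Eq.symm hx.2))
    · exact fun hx => absurd (Finset.mem_univ _) hx
  rw [action, integral_congr_ae h,
    integral_finsetSum _ fun e _ => (integrable_const _).indicator (hms e)]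
  refine Finset.sum_congr rfl fun e _ => ?_
  rw [integral_indicator_const _ (hms e), smul_eq_mul]
  rfl

lemma exp_neg_grid_lt {m : ℕ} (hm : 0 < m) : Real.exp (-2 * (m : ℝ)⁻¹) < 1 := by
  have : (0 : ℝ) < (m : ℝ)⁻¹ := inv_pos.2 (Nat.cast_pos.2 hm)
  rw [Real.exp_lt_one_iff]
  linarith

/-- Every edge contributes its weight for unequal spins as a constant: (1 - e^{-2/m})/2 for
neighbours and e^{-J} for a coupling J. The remaining factor is 1 plus an edge weight on equal
spins, which is where `gridEdgeWeight` comes from. -/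
lemma chainWeight_mul_exp {m K : ℕ} (hm : 0 < m) (σ : Fin (K + 1) → ℤˣ) :
    chainWeight K (m : ℝ)⁻¹ σ
        * Real.exp (∑ e : Fin (K + 1) × Fin (K + 1), gridCoupling β m e * spinProd σ e.1 e.2)
      = (((1 - Real.exp (-2 * (m : ℝ)⁻¹)) / 2) ^ K *
          ∏ e : Fin (K + 1) × Fin (K + 1), Real.exp (-gridCoupling β m e))
        * isingWeight (gridEnds K) (gridEdgeWeight β m K) σ := by
  have hq := exp_neg_grid_lt hm
  have h1 : chainWeight K (m : ℝ)⁻¹ σ = ((1 - Real.exp (-2 * (m : ℝ)⁻¹)) / 2) ^ K *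
      ∏ i : Fin K, (1 + if σ i.castSucc = σ i.succ then
        2 * Real.exp (-2 * (m : ℝ)⁻¹) / (1 - Real.exp (-2 * (m : ℝ)⁻¹)) else 0) := by
    have : ((1 - Real.exp (-2 * (m : ℝ)⁻¹)) / 2) ^ K
        = ∏ _i : Fin K, ((1 - Real.exp (-2 * (m : ℝ)⁻¹)) / 2) := by
      rw [Finset.prod_const, Finset.card_univ, Fintype.card_fin]
    rw [this, chainWeight, ← Finset.prod_mul_distrib]
    refine Finset.prod_congr rfl fun i _ => ?_
    have : 1 - Real.exp (-2 * (m : ℝ)⁻¹) ≠ 0 := by linarith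
    rw [spinProd_eq_ite]
    split_ifs
    · rw [div_mul_eq_mul_div, mul_add, mul_div_cancel₀ _ this]
      ring
    · ring
  have h2 : Real.exp (∑ e : Fin (K + 1) × Fin (K + 1), gridCoupling β m e * spinProd σ e.1 e.2)
      = (∏ e : Fin (K + 1) × Fin (K + 1), Real.exp (-gridCoupling β m e)) *
        ∏ e : Fin (K + 1) × Fin (K + 1),
          (1 + if σ e.1 = σ e.2 then Real.exp (2 * gridCoupling β m e) - 1 else 0) := by
    rw [Real.exp_sum, ← Finset.prod_mul_distrib]
    refine Finset.prod_congr rfl fun e _ => ?_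
    rw [spinProd_eq_ite]
    split_ifs
    · rw [add_sub_cancel, ← Real.exp_add]
      ring_nf
    · simp
  rw [h1, h2, isingWeight, Fintype.prod_sum_type]
  simp only [gridEnds, gridEdgeWeight, Sum.elim_inl, Sum.elim_inr, id]
  exact mul_mul_mul_comm _ _ _ _

/-- The Ising correlation on the grid between the grid points with indices `0` and `k`. -/
def gridCorr (β : Measure (ℝ × ℝ)) (m K : ℕ) (k : Fin (K + 1)) : ℝ :=
  (∑ σ, spinProd σ 0 k * isingWeight (gridEnds K) (gridEdgeWeight β m K) σ)
    / ∑ σ, isingWeight (gridEnds K) (gridEdgeWeight β m K) σ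

lemma sum_plus_eq {K : ℕ} {G : (Fin (K + 1) → ℤˣ) → ℝ} (hG : ∀ σ, G (-σ) = G σ) :
    ∑ σ : Fin (K + 1) → ℤˣ, (if σ 0 = 1 then 1 else 0) * G σ = 2⁻¹ * ∑ σ, G σ := by
  have h1 : ∑ σ : Fin (K + 1) → ℤˣ, (if σ 0 = 1 then 1 else 0) * G σ
      = ∑ σ : Fin (K + 1) → ℤˣ, (if σ 0 = 1 then 0 else 1) * G σ := by
    rw [← Equiv.sum_comp (Equiv.neg (Fin (K + 1) → ℤˣ))]
    refine Finset.sum_congr rfl fun σ _ => ?_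
    have : -σ 0 = 1 ↔ ¬ σ 0 = 1 := by rw [neg_eq_iff_eq_neg, units_eq_neg_iff]
    simp only [Equiv.neg_apply, Pi.neg_apply, this, hG]
    split_ifs <;> simp_all
  have h2 : (∑ σ : Fin (K + 1) → ℤˣ, (if σ 0 = 1 then 1 else 0) * G σ)
      + ∑ σ : Fin (K + 1) → ℤˣ, (if σ 0 = 1 then 0 else 1) * G σ = ∑ σ, G σ := by
    rw [← Finset.sum_add_distrib]
    refine Finset.sum_congr rfl fun σ _ => ?_
    split_ifs <;> ring
  linarith

/-- The walk starts in 1, while the Ising sums run over all configurations. Global spin-flip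
symmetry makes the restriction to `σ 0 = 1` a factor 1/2 in both numerator and denominator. -/
lemma integral_div_integral_eq_gridCorr {m K : ℕ} (hm : 0 < m)
    (hβ : ∀ᵐ p ∂β, (m : ℝ) * p.1 ≤ K ∧ (m : ℝ) * p.2 ≤ K) (k : Fin (K + 1)) :
    (∫ w, parity w (k * (m : ℝ)⁻¹) * Real.exp (action β (gridUp m) w) ∂waitLaw)
      / ∫ w, Real.exp (action β (gridUp m) w) ∂waitLaw = gridCorr β m K k := by
  have hh : 0 ≤ (m : ℝ)⁻¹ := by positivity
  have hq := exp_neg_grid_lt hm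
  simp only [action_gridUp_eq hβ]
  rw [integral_gridSpin hh K (fun σ => Real.exp (∑ e : Fin (K + 1) × Fin (K + 1),
    gridCoupling β m e * spinProd σ e.1 e.2))]
  simp only [← coe_gridSpin K]
  rw [integral_gridSpin hh K (fun σ => ((σ k : ℤ) : ℝ) *
    Real.exp (∑ e : Fin (K + 1) × Fin (K + 1), gridCoupling β m e * spinProd σ e.1 e.2))]
  set c := ((1 - Real.exp (-2 * (m : ℝ)⁻¹)) / 2) ^ K *
          ∏ e : Fin (K + 1) × Fin (K + 1), Real.exp (-gridCoupling β m e) with hc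
  have hcpos : 0 < c := mul_pos (pow_pos (by linarith) _)
    (Finset.prod_pos fun e _ => Real.exp_pos _)
  have hI : ∀ σ, isingWeight (gridEnds K) (gridEdgeWeight β m K) (-σ)
      = isingWeight (gridEnds K) (gridEdgeWeight β m K) σ := fun σ => by
    simp only [isingWeight, Pi.neg_apply, neg_inj]
  have h1 : ∑ σ : Fin (K + 1) → ℤˣ, (if σ 0 = 1 then (1 : ℝ) else 0) *
      (Real.exp (∑ e : Fin (K + 1) × Fin (K + 1), gridCoupling β m e * spinProd σ e.1 e.2)
        * chainWeight K (m : ℝ)⁻¹ σ)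
      = c * 2⁻¹ * ∑ σ, isingWeight (gridEnds K) (gridEdgeWeight β m K) σ := by
    rw [mul_assoc, ← sum_plus_eq hI, Finset.mul_sum]
    refine Finset.sum_congr rfl fun σ _ => ?_
    rw [mul_comm (Real.exp _), chainWeight_mul_exp hm]
    ring
  have h2 : ∑ σ : Fin (K + 1) → ℤˣ, (if σ 0 = 1 then (1 : ℝ) else 0) * (((σ k : ℤ) : ℝ) *
      Real.exp (∑ e : Fin (K + 1) × Fin (K + 1), gridCoupling β m e * spinProd σ e.1 e.2)
        * chainWeight K (m : ℝ)⁻¹ σ)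
      = c * 2⁻¹ * ∑ σ, spinProd σ 0 k * isingWeight (gridEnds K) (gridEdgeWeight β m K) σ := by
    rw [mul_assoc, ← sum_plus_eq (G := fun σ => spinProd σ 0 k *
      isingWeight (gridEnds K) (gridEdgeWeight β m K) σ) (fun σ => by
        simp only [hI, spinProd_eq_ite, Pi.neg_apply, neg_inj]), Finset.mul_sum]
    refine Finset.sum_congr rfl fun σ _ => ?_
    rw [mul_assoc, mul_comm (Real.exp _), chainWeight_mul_exp hm]
    by_cases h0 : σ 0 = 1
    · simp only [spinProd, h0, one_mul, if_true]
      ring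
    · simp [h0]
  rw [h1, h2, gridCorr, mul_div_mul_left _ _ (by positivity)]

lemma gridEdgeWeight_nonneg {m : ℕ} (hm : 0 < m) (K : ℕ) : 0 ≤ gridEdgeWeight β m K := by
  have hq := exp_neg_grid_lt hm
  rintro (i | e)
  · exact div_nonneg (by positivity) (by linarith)
  · have : 0 ≤ 2 * gridCoupling β m e := mul_nonneg zero_le_two measureReal_nonneg
    simpa [gridEdgeWeight] using this

lemma gridCorr_mono {β' : Measure (ℝ × ℝ)} [IsFiniteMeasure β'] (h : β ≤ β') {m : ℕ} (hm : 0 < m)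
    (K : ℕ) (k : Fin (K + 1)) : gridCorr β m K k ≤ gridCorr β' m K k := by
  refine ising_correlation_mono _ (gridEdgeWeight_nonneg hm K) ?_ _ _
  rintro (i | e)
  · exact le_rfl
  · have : gridCoupling β m e ≤ gridCoupling β' m e :=
      ENNReal.toReal_mono (measure_ne_top _ _) (h _)
    simpa [gridEdgeWeight] using this

lemma ae_boxIntensity (g : ℝ → ℝ) (α T : ℝ) :
    ∀ᵐ p ∂(boxIntensity g α T), p ∈ Set.Icc 0 T ×ˢ Set.Icc 0 T :=
  ae_restrict_mem (measurableSet_box T)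

end Discretisation

/-! ### Monotonicity in the time horizon and the limit `T → ∞`. -/

section Limit

variable {g : ℝ → ℝ} {α : ℝ}

/-- The time `n` is the grid point with index `m * n` for every mesh 1/m, so the observable is exact
and only the energy is rounded. The grid reaches up to `M` independently of `T`, which lets two
horizons share one grid. -/
lemma tendsto_gridCorr (hg : Continuous g) (hg_even : ∀ t, g (-t) = g t)
    (hg_nonneg : ∀ t, 0 ≤ g t) (hα : 0 ≤ α) {n M : ℕ} (hn : n ≤ M) {T : ℝ} (hT : T ≤ M) :
    Tendsto (fun m => gridCorr (boxIntensity g α T) m (m * M) (Fin.ofNat (m * M + 1) (m * n)))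
      atTop (𝓝 (twoPointT g α T n)) := by
  have hfin := isFiniteMeasure_boxIntensity hg α T
  have hβ : ∀ᵐ p ∂(boxIntensity g α T), 0 ≤ p.1 ∧ 0 ≤ p.2 := by
    filter_upwards [ae_boxIntensity g α T] with p hp using ⟨hp.1.1, hp.2.1⟩
  rw [twoPointT_eq hg hg_even hg_nonneg hα]
  have h1 := tendsto_integral_exp_action (f := fun w => parity w n) (measurable_parity n)
    (fun w => (abs_parity w n).le) hβ
  have h2 := tendsto_integral_exp_action (f := fun _ => 1) measurable_const (by simp) hβ
  simp only [one_mul] at h2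
  refine (h1.div h2 (integral_exp_action_pos _ measurable_id).ne').congr' ?_
  filter_upwards [eventually_gt_atTop 0] with m hm
  have hm' : (0 : ℝ) < m := Nat.cast_pos.2 hm
  have h3 : ∀ᵐ p ∂(boxIntensity g α T),
      (m : ℝ) * p.1 ≤ (m * M : ℕ) ∧ (m : ℝ) * p.2 ≤ (m * M : ℕ) := by
    filter_upwards [ae_boxIntensity g α T] with p hp
    push_cast
    exact ⟨mul_le_mul_of_nonneg_left (hp.1.2.trans hT) hm'.le,
      mul_le_mul_of_nonneg_left (hp.2.2.trans hT) hm'.le⟩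
  rw [← integral_div_integral_eq_gridCorr hm h3]
  -- `Fin.ofNat` reduces modulo `m * M + 1`; since `n ≤ M`, there is no wrap-around.
  have h4 : ((Fin.ofNat (m * M + 1) (m * n) : Fin (m * M + 1)) : ℕ) = m * n :=
    Nat.mod_eq_of_lt (Nat.lt_succ_of_le (Nat.mul_le_mul_left m hn))
  have h5 : ((m * n : ℕ) : ℝ) * (m : ℝ)⁻¹ = n := by
    push_cast
    field_simp
  rw [h4, h5]
  rfl

/-- A longer horizon enlarges the bond intensity and hence every grid coupling; Griffiths'
inequality on a common grid survives the limit. -/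
lemma twoPointT_mono (hg : Continuous g) (hg_even : ∀ t, g (-t) = g t)
    (hg_nonneg : ∀ t, 0 ≤ g t) (hα : 0 ≤ α) (n : ℕ) : Monotone fun T => twoPointT g α T n := by
  intro T T' h
  obtain ⟨M, hM⟩ := exists_nat_ge (max T' n)
  have hn : n ≤ M := Nat.cast_le.1 ((le_max_right _ _).trans hM)
  have hT' : T' ≤ M := (le_max_left _ _).trans hM
  have := isFiniteMeasure_boxIntensity hg α T
  have := isFiniteMeasure_boxIntensity hg α T'
  refine le_of_tendsto_of_tendsto
    (tendsto_gridCorr hg hg_even hg_nonneg hα hn (h.trans hT'))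
    (tendsto_gridCorr hg hg_even hg_nonneg hα hn hT') ?_
  filter_upwards [eventually_gt_atTop 0] with m hm
  exact gridCorr_mono (boxIntensity_mono g α h) hm _ _

lemma twoPointT_le_one (hg : Continuous g) (hg_even : ∀ t, g (-t) = g t)
    (hg_nonneg : ∀ t, 0 ≤ g t) (hα : 0 ≤ α) (T t : ℝ) : twoPointT g α T t ≤ 1 := by
  have hfin := isFiniteMeasure_boxIntensity hg α T
  have hm := Real.measurable_exp.comp (measurable_action (boxIntensity g α T) measurable_id)
  have hi : Integrable (fun w => Real.exp (action (boxIntensity g α T) id w)) waitLaw :=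
    Integrable.of_bound hm.aestronglyMeasurable _
      (Eventually.of_forall fun w => exp_action_le _ id w)
  rw [twoPointT_eq hg hg_even hg_nonneg hα, div_le_one (integral_exp_action_pos _ measurable_id)]
  refine integral_mono (hi.bdd_mul (c := 1) (measurable_parity t).aestronglyMeasurable
    (Eventually.of_forall fun w => (abs_parity w t).le)) hi fun w => ?_
  exact mul_le_of_le_one_left (Real.exp_pos _).le ((le_abs_self _).trans (abs_parity w t).le)

lemma tendsto_twoPointT (hg : Continuous g) (hg_even : ∀ t, g (-t) = g t)
    (hg_nonneg : ∀ t, 0 ≤ g t) (hα : 0 ≤ α) (n : ℕ) :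
    Tendsto (fun T => twoPointT g α T n) atTop (𝓝 (twoPoint g α n)) :=
  tendsto_nhds_limUnder ⟨_, tendsto_atTop_ciSup (twoPointT_mono hg hg_even hg_nonneg hα n)
    ⟨1, by rintro _ ⟨T, rfl⟩; exact twoPointT_le_one hg hg_even hg_nonneg hα T n⟩⟩

lemma twoPointT_le_twoPoint (hg : Continuous g) (hg_even : ∀ t, g (-t) = g t)
    (hg_nonneg : ∀ t, 0 ≤ g t) (hα : 0 ≤ α) (n : ℕ) (T : ℝ) :
    twoPointT g α T n ≤ twoPoint g α n :=
  (twoPointT_mono hg hg_even hg_nonneg hα n).ge_of_tendsto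
    (tendsto_twoPointT hg hg_even hg_nonneg hα n) T

end Limit

/-! ### Void probabilities of Poisson processes and a Fatou bound. -/

section PoissonProcess

set_option linter.unusedSectionVars false

variable {Ω E : Type*} [MeasurableSpace Ω] [MeasurableSpace E] {ξ : Ω → Set E} {μ : Measure E}
  {P : Measure Ω}

lemma IsPoissonProcess.measure_countIn_eq_zero (h : IsPoissonProcess ξ μ P) {B : Set E}
    (hB : MeasurableSet B) (hμ : μ B ≠ ∞) :
    P {ω | countIn ξ B ω = 0} = ENNReal.ofReal (Real.exp (-μ.real B)) := by
  have := h.count_law B hB hμ 0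
  simp only [Nat.cast_zero, poissonMeasure_singleton, pow_zero, mul_one, Nat.factorial_zero,
    Nat.cast_one, div_one] at this
  exact this

lemma IsPoissonProcess.ae_countIn_ne_top [IsProbabilityMeasure P] (h : IsPoissonProcess ξ μ P)
    {B : Set E} (hB : MeasurableSet B) (hμ : μ B ≠ ∞) : ∀ᵐ ω ∂P, countIn ξ B ω ≠ ⊤ := by
  have hm : ∀ k : ℕ, MeasurableSet {ω | countIn ξ B ω = k} := fun k =>
    h.measurable_count B hB (measurableSet_singleton _)
  have h1 : P (⋃ k : ℕ, {ω | countIn ξ B ω = k}) = 1 := by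
    rw [measure_iUnion _ hm]
    · simp_rw [h.count_law B hB hμ]
      rw [← measure_iUnion (fun i j hij => Set.disjoint_singleton.2 hij)
        fun i => measurableSet_singleton i, Set.iUnion_of_singleton, measure_univ]
    · intro i j hij
      refine Set.disjoint_left.2 fun ω hi hj => hij ?_
      exact Nat.cast_injective (R := ℕ∞) (Eq.trans (Eq.symm hi) hj)
  have h2 := (prob_compl_eq_zero_iff (MeasurableSet.iUnion hm)).2 h1
  rw [ae_iff]
  refine measure_mono_null (fun ω hω => ?_) h2
  simp only [not_not, Set.mem_ofPred_eq] at hω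
  simp [hω]

/-- The event that `O` is the set of indices `i` for which there is no point in `B i`. -/
def emptyPattern {ι : Type*} (ξ : Ω → Set E) (B : ι → Set E) (O : ι → Prop) : Set Ω :=
  {ω | ∀ i, countIn ξ (B i) ω = 0 ↔ O i}

lemma measurableSet_emptyPattern {ι : Type*} [Countable ι] {B : ι → Set E}
    (hB : ∀ i, MeasurableSet (B i)) (O : ι → Prop) :
    MeasurableSet[configSigma ξ] (emptyPattern ξ B O) := by
  simp only [emptyPattern, Set.ofPred_forall]
  refine MeasurableSet.iInter fun i => ?_
  have h1 : MeasurableSet[configSigma ξ] {ω | countIn ξ (B i) ω = 0} := by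
    refine le_iSup₂ (f := fun (B : Set E) (_ : MeasurableSet B) =>
      MeasurableSpace.comap (countIn ξ B) ⊤) (B i) (hB i) _ ?_
    exact ⟨{0}, trivial, rfl⟩
  by_cases hO : O i
  · simpa [hO] using h1
  · simp only [hO, iff_false]
    exact h1.compl

open scoped Classical in
lemma IsPoissonProcess.measure_emptyPattern [IsProbabilityMeasure P] (h : IsPoissonProcess ξ μ P)
    {ι : Type*} [Fintype ι] {B : ι → Set E} (hB : ∀ i, MeasurableSet (B i))
    (hdisj : Pairwise fun i j => Disjoint (B i) (B j)) (hμ : ∀ i, μ (B i) ≠ ∞) (O : ι → Prop) :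
    P.real (emptyPattern ξ B O)
      = ∏ i, if O i then Real.exp (-μ.real (B i)) else 1 - Real.exp (-μ.real (B i)) := by
  have hind : iIndepFun (fun i => countIn ξ (B i)) P := by
    have h1 := h.indep_count _ (fun i => B ((Fintype.equivFin ι).symm i)) (fun i => hB _)
      fun i j hij => hdisj ((Fintype.equivFin ι).symm.injective.ne hij)
    have h2 := h1.precomp (Fintype.equivFin ι).injective
    simpa using h2
  let S : ι → Set ℕ∞ := fun i => if O i then {0} else {0}ᶜ
  have hS : ∀ i, MeasurableSet (S i) := fun i => by
    dsimp only [S]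
    split_ifs
    exacts [measurableSet_singleton _, (measurableSet_singleton _).compl]
  have h1 : emptyPattern ξ B O = ⋂ i ∈ Finset.univ, countIn ξ (B i) ⁻¹' S i := by
    ext ω
    simp only [emptyPattern, Set.mem_iInter, Finset.mem_univ, true_imp_iff, Set.mem_preimage, S,
      Set.mem_ofPred_eq]
    refine forall_congr' fun i => ?_
    by_cases hO : O i <;> simp [hO]
  rw [h1, Measure.real, hind.measure_inter_preimage_eq_mul Finset.univ fun i _ => hS i,
    ENNReal.toReal_prod]
  refine Finset.prod_congr rfl fun i _ => ?_
  have h2 : P.real (countIn ξ (B i) ⁻¹' {0}) = Real.exp (-μ.real (B i)) := by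
    have := h.measure_countIn_eq_zero (hB i) (hμ i)
    rw [Measure.real, show countIn ξ (B i) ⁻¹' {0} = {ω | countIn ξ (B i) ω = 0} from rfl, this,
      ENNReal.toReal_ofReal (Real.exp_pos _).le]
  by_cases hO : O i
  · simp only [S, if_pos hO]
    exact h2
  · have h3 := probReal_compl_eq_one_sub (μ := P)
      (h.measurable_count _ (hB i) (measurableSet_singleton 0))
    rw [h2] at h3
    simp only [S, if_neg hO]
    exact h3

/-- A Fatou type bound for the event that all but finitely many of a sequence of events hold. -/
lemma measureReal_le_of_eventually_mem [IsFiniteMeasure P] {D : ℕ → Set Ω} {a : ℕ → ℝ} {c : ℝ}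
    (ha : Tendsto a atTop (𝓝 c)) (hD : ∀ᶠ m in atTop, P.real (D m) ≤ a m) {C : Set Ω}
    (hC : ∀ᵐ ω ∂P, ω ∈ C → ∀ᶠ m in atTop, ω ∈ D m) : P.real C ≤ c := by
  have hc : 0 ≤ c := ge_of_tendsto ha (hD.mono fun m hm => measureReal_nonneg.trans hm)
  have h1 : P C ≤ P (⋃ k : ℕ, ⋂ m ∈ Set.Ici k, D m) := by
    refine measure_mono_ae ?_
    filter_upwards [hC] with ω hω h
    obtain ⟨k, hk⟩ := eventually_atTop.1 (hω h)
    exact Set.mem_iUnion.2 ⟨k, Set.mem_iInter₂.2 hk⟩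
  -- Continuity from below along increasing sequences holds for arbitrary sets, so neither `C` nor
  -- the `D m` have to be measurable.
  have hmono : Monotone fun k : ℕ => ⋂ m ∈ Set.Ici k, D m := fun k l hkl =>
    Set.biInter_subset_biInter_left (Set.Ici_subset_Ici.2 hkl)
  rw [hmono.measure_iUnion] at h1
  refine ENNReal.toReal_le_of_le_ofReal hc (h1.trans (iSup_le fun k => ?_))
  refine ge_of_tendsto (ENNReal.tendsto_ofReal ha) ?_
  filter_upwards [hD, eventually_ge_atTop k] with m hm hkm
  refine (measure_mono (Set.biInter_subset_of_mem hkm)).trans ?_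
  rw [← ofReal_measureReal]
  exact ENNReal.ofReal_le_ofReal hm

end PoissonProcess

/-! ### Continuum connections persist on fine grids. -/

section Percolation

/-- The rectangle of the bonds that join the grid cells `i` and `j` within the square `[0, M]²`. -/
def gridRect (m M i j : ℕ) : Set (ℝ × ℝ) :=
  (gridCell m i ×ˢ gridCell m j) ∩ (Set.Icc (0 : ℝ) M ×ˢ Set.Icc (0 : ℝ) M)

open scoped Classical in
/-- The open edges on the grid: a nearest neighbour edge is open if there is no cut between its
endpoints, a long edge is open if there is a bond between the corresponding cells. -/
def openEdges (m M : ℕ) (S : Set ℝ) (B : Set (ℝ × ℝ)) :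
    Finset (Fin (m * M) ⊕ Fin (m * M + 1) × Fin (m * M + 1)) :=
  Finset.univ.filter (Sum.elim (fun i => (S ∩ gridCell m (i + 1)).encard = 0)
    fun e => (B ∩ gridRect m M e.1 e.2).encard ≠ 0)

/-- The vertex of the grid that represents the point `x`. -/
def gridNode (m M : ℕ) (x : ℝ) : Fin (m * M + 1) := Fin.ofNat (m * M + 1) ⌈(m : ℝ) * x⌉₊

lemma ceil_mul_le {m M : ℕ} {x : ℝ} (hx : x ≤ M) : ⌈(m : ℝ) * x⌉₊ ≤ m * M := by
  refine Nat.ceil_le.2 ?_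
  push_cast
  exact mul_le_mul_of_nonneg_left hx (Nat.cast_nonneg m)

lemma val_gridNode {m M : ℕ} {x : ℝ} (hx : x ≤ M) :
    (gridNode m M x : ℕ) = ⌈(m : ℝ) * x⌉₊ :=
  Nat.mod_eq_of_lt (Nat.lt_succ_of_le (ceil_mul_le hx))

/-- The points `x` and `y` are connected on every sufficiently fine grid in a large box. -/
def GridLinked (S : Set ℝ) (B : Set (ℝ × ℝ)) (x y : ℝ) : Prop :=
  ∀ᶠ M : ℕ in atTop, ∀ᶠ m : ℕ in atTop,
    Linked (gridEnds (m * M)) (openEdges m M S B) (gridNode m M x) (gridNode m M y)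

variable {S : Set ℝ} {B : Set (ℝ × ℝ)} {x y z : ℝ}

lemma GridLinked.symm (h : GridLinked S B x y) : GridLinked S B y x :=
  h.mono fun _ hM => hM.mono fun _ hm σ hσ => (hm σ hσ).symm

lemma GridLinked.trans (h : GridLinked S B x y) (h' : GridLinked S B y z) :
    GridLinked S B x z :=
  (h.and h').mono fun _ hM => (hM.1.and hM.2).mono fun _ hm σ hσ =>
    (hm.1 σ hσ).trans (hm.2 σ hσ)

/-- The bond itself opens the long edge between the cells of its endpoints, for every mesh, once the
box contains it. -/
lemma gridLinked_of_bond {p : ℝ × ℝ} (hp : p ∈ B) (h1 : 0 ≤ p.1) (h2 : 0 ≤ p.2) :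
    GridLinked S B p.1 p.2 := by
  obtain ⟨M₀, hM₀⟩ := exists_nat_ge (max p.1 p.2)
  filter_upwards [eventually_ge_atTop M₀] with M hM
  have hM' : (M₀ : ℝ) ≤ M := Nat.cast_le.2 hM
  have h1M : p.1 ≤ M := (le_max_left _ _).trans (hM₀.trans hM')
  have h2M : p.2 ≤ M := (le_max_right _ _).trans (hM₀.trans hM')
  refine Eventually.of_forall fun m σ hσ => ?_
  have hmem : (Sum.inr (gridNode m M p.1, gridNode m M p.2) :
      Fin (m * M) ⊕ Fin (m * M + 1) × Fin (m * M + 1)) ∈ openEdges m M S B := by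
    simp only [openEdges, Finset.mem_filter, Finset.mem_univ, true_and, Sum.elim_inr]
    rw [Set.encard_ne_zero]
    refine ⟨p, hp, ⟨?_, ?_⟩, ⟨h1, h1M⟩, ⟨h2, h2M⟩⟩
    · exact (val_gridNode h1M).symm
    · exact (val_gridNode h2M).symm
  exact hσ _ hmem

/-- The neighbour edges between the rounded points cover cells inside `(x, gridUp m y]`. A cut there
could only lie beyond `y`, and local finiteness excludes this for a fine mesh. -/
lemma gridLinked_of_disjoint (hS : ∀ N : ℕ, (S ∩ Set.Icc 0 (N : ℝ)).Finite) (hx : 0 ≤ x)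
    (hxy : x ≤ y) (hd : Disjoint S (Set.Ioc x y)) : GridLinked S B x y := by
  obtain ⟨M₀, hM₀⟩ := exists_nat_ge (y + 1)
  filter_upwards [eventually_ge_atTop M₀] with M hM
  have hM' : (M₀ : ℝ) ≤ M := Nat.cast_le.2 hM
  have hyM : y ≤ M := by linarith
  have hfin : (S ∩ Set.Ioc y (y + 1)).Finite := (hS M₀).subset
    (Set.inter_subset_inter_right _ fun s hs => ⟨by linarith [hs.1], hs.2.trans hM₀⟩)
  have hev : ∀ᶠ s in 𝓝[≥] y, ∀ c ∈ S ∩ Set.Ioc y (y + 1), s < c := by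
    rw [Filter.eventually_all_finite hfin]
    intro c hc
    filter_upwards [Ico_mem_nhdsGE hc.2.1] with s hs using hs.2
  have hev' : ∀ᶠ s in 𝓝[≥] y, s < y + 1 := by
    filter_upwards [Ico_mem_nhdsGE (show y < y + 1 by linarith)] with s hs using hs.2
  filter_upwards [(tendsto_gridUp (hx.trans hxy)).eventually hev,
    (tendsto_gridUp (hx.trans hxy)).eventually hev', eventually_gt_atTop 0] with m hm1 hm2 hm0
  have hm : (0 : ℝ) < m := Nat.cast_pos.2 hm0
  intro σ hσ
  have hstep : ∀ k, ⌈(m : ℝ) * x⌉₊ ≤ k → k ≤ ⌈(m : ℝ) * y⌉₊ →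
      σ (gridNode m M x) = σ (Fin.ofNat (m * M + 1) k) := by
    intro k hk
    induction k, hk using Nat.le_induction with
    | base => exact fun _ => rfl
    | succ k hk ih =>
      intro hky
      rw [ih (Nat.le_of_succ_le hky)]
      have hkM : k < m * M := Nat.lt_of_succ_le (hky.trans (ceil_mul_le hyM))
      have hmem : (Sum.inl ⟨k, hkM⟩ :
          Fin (m * M) ⊕ Fin (m * M + 1) × Fin (m * M + 1)) ∈ openEdges m M S B := by
        simp only [openEdges, Finset.mem_filter, Finset.mem_univ, true_and, Sum.elim_inl]
        rw [Set.encard_eq_zero, ← Set.disjoint_iff_inter_eq_empty]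
        refine Set.disjoint_left.2 fun s hs hcell => ?_
        have hceil : ⌈(m : ℝ) * s⌉₊ = k + 1 := hcell
        have h1 : x < s := by
          have : (k : ℝ) < m * s := Nat.lt_ceil.1 (by omega)
          have h2 : (m : ℝ) * x ≤ k := Nat.ceil_le.1 hk
          exact lt_of_mul_lt_mul_left (h2.trans_lt this) hm.le
        have h2 : s ≤ gridUp m y := by
          have h3 : (m : ℝ) * s ≤ ⌈(m : ℝ) * y⌉₊ := Nat.ceil_le.1 (hceil.le.trans hky)
          rw [gridUp, ← div_eq_mul_inv, le_div_iff₀ hm, mul_comm]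
          exact h3
        by_cases hsy : s ≤ y
        · exact Set.disjoint_left.1 hd hs ⟨h1, hsy⟩
        · exact absurd h2 (not_le.2 (hm1 s ⟨hs, not_le.1 hsy, h2.trans hm2.le⟩))
      have h1 : (Fin.ofNat (m * M + 1) k) = (⟨k, hkM⟩ : Fin (m * M)).castSucc :=
        Fin.ext (Nat.mod_eq_of_lt (hkM.trans (Nat.lt_succ_self _)))
      have h2 : (Fin.ofNat (m * M + 1) (k + 1)) = (⟨k, hkM⟩ : Fin (m * M)).succ :=
        Fin.ext (Nat.mod_eq_of_lt (Nat.succ_lt_succ hkM))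
      rw [h1, h2]
      exact hσ _ hmem
  exact hstep _ (Nat.ceil_mono (mul_le_mul_of_nonneg_left hxy hm.le)) le_rfl

lemma gridLinked_of_mem_cell (hS : ∀ N : ℕ, (S ∩ Set.Icc 0 (N : ℝ)).Finite)
    (hx : x ∈ cell S z) (hy : y ∈ cell S z) : GridLinked S B x y := by
  wlog hxy : x ≤ y generalizing x y
  · exact (this hy hx (not_le.1 hxy).le).symm
  refine gridLinked_of_disjoint hS hx.1 hxy (Set.disjoint_left.2 fun s hs hs' => ?_)
  by_cases hsz : s ≤ z
  · refine Set.disjoint_left.1 hx.2 hs ?_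
    rw [Set.uIoc_of_ge (hs'.1.le.trans hsz)]
    exact ⟨hs'.1, hsz⟩
  · refine Set.disjoint_left.1 hy.2 hs ?_
    rw [Set.uIoc_of_le ((not_le.1 hsz).le.trans hs'.2)]
    exact ⟨not_le.1 hsz, hs'.2⟩

/-- A walk has finitely many steps, so the thresholds for box and mesh in `GridLinked` can be
combined along it. -/
lemma gridLinked_of_walk (hS : ∀ N : ℕ, (S ∩ Set.Icc 0 (N : ℝ)).Finite) {I J : Set ℝ}
    (p : (cellGraph S B).Walk I J) (hI : ∃ z, I = cell S z) (hx : x ∈ I) (hy : y ∈ J) :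
    GridLinked S B x y := by
  induction p generalizing x with
  | nil =>
    obtain ⟨z, rfl⟩ := hI
    exact gridLinked_of_mem_cell hS hx hy
  | @cons I I' J hadj p ih =>
    obtain ⟨_, ⟨a, _, rfl⟩, ⟨b, _, rfl⟩, q, hq, hends⟩ := hadj
    rcases hends with ⟨h1, h2⟩ | ⟨h1, h2⟩
    · exact (gridLinked_of_mem_cell hS hx h1).trans
        ((gridLinked_of_bond hq h1.1 h2.1).trans (ih ⟨b, rfl⟩ h2 hy))
    · exact (gridLinked_of_mem_cell hS hx h2).trans
        ((gridLinked_of_bond hq h1.1 h2.1).symm.trans (ih ⟨b, rfl⟩ h1 hy))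

lemma Connected.gridLinked (hS : ∀ N : ℕ, (S ∩ Set.Icc 0 (N : ℝ)).Finite) (hx : 0 ≤ x)
    (hy : 0 ≤ y) (h : Connected S B x y) : GridLinked S B x y := by
  obtain ⟨p⟩ := h
  exact gridLinked_of_walk hS p ⟨x, rfl⟩ ⟨hx, by simp⟩ ⟨hy, by simp⟩

end Percolation

/-! ### Grid percolation against the grid Ising model. -/

section Comparison

lemma gridCell_succ {m : ℕ} (hm : 0 < m) (i : ℕ) :
    gridCell m (i + 1) = Set.Ioc (i / (m : ℝ)) ((i + 1) / (m : ℝ)) := by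
  have hm' : (0 : ℝ) < m := Nat.cast_pos.2 hm
  ext s
  simp only [gridCell, Set.mem_ofPred_eq, Set.mem_Ioc]
  rw [Nat.ceil_eq_iff (Nat.succ_ne_zero i), div_lt_iff₀ hm', le_div_iff₀ hm', mul_comm s]
  simp

lemma disjoint_gridCell (m : ℕ) {i j : ℕ} (h : i ≠ j) : Disjoint (gridCell m i) (gridCell m j) :=
  Set.disjoint_left.2 fun _ hi hj => h (Eq.trans (Eq.symm hi) hj)

lemma cutIntensity_gridCell {m : ℕ} (hm : 0 < m) (i : ℕ) :
    cutIntensity (gridCell m (i + 1)) = ENNReal.ofReal (2 * (m : ℝ)⁻¹) := by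
  have hm' : (0 : ℝ) < m := Nat.cast_pos.2 hm
  have h : gridCell m (i + 1) ∩ Set.Ici 0 = gridCell m (i + 1) := by
    rw [gridCell_succ hm, Set.inter_eq_left]
    intro s hs
    exact le_trans (by positivity) hs.1.le
  rw [cutIntensity, Measure.smul_apply, Measure.restrict_apply (measurableSet_gridCell _ _), h,
    gridCell_succ hm, Real.volume_Ioc, ENNReal.ofReal_mul zero_le_two, ENNReal.ofReal_ofNat,
    smul_eq_mul, ← sub_div, add_sub_cancel_left, one_div]

lemma cutIntensity_Icc_ne_top (N : ℝ) : cutIntensity (Set.Icc 0 N) ≠ ∞ := by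
  rw [cutIntensity, Measure.smul_apply, smul_eq_mul]
  refine ENNReal.mul_ne_top (by simp) (ne_top_of_le_ne_top ?_ (Measure.restrict_apply_le _ _))
  simp

lemma measurableSet_gridRect (m M i j : ℕ) : MeasurableSet (gridRect m M i j) :=
  ((measurableSet_gridCell m i).prod (measurableSet_gridCell m j)).inter (measurableSet_box _)

lemma bondIntensity_gridRect (g : ℝ → ℝ) (α : ℝ) (m M : ℕ)
    (e : Fin (m * M + 1) × Fin (m * M + 1)) :
    (bondIntensity g α).real (gridRect m M e.1 e.2) = gridCoupling (boxIntensity g α M) m e := by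
  rw [gridCoupling, boxIntensity, Measure.real, Measure.real,
    Measure.restrict_apply ((measurableSet_gridCell m _).prod (measurableSet_gridCell m _))]
  rfl

lemma bondIntensity_gridRect_ne_top {g : ℝ → ℝ} (hg : Continuous g) (α : ℝ) (m M i j : ℕ) :
    bondIntensity g α (gridRect m M i j) ≠ ∞ := by
  have := isFiniteMeasure_boxIntensity hg α M
  have h := measure_ne_top (boxIntensity g α M) (gridCell m i ×ˢ gridCell m j)
  rwa [boxIntensity, Measure.restrict_apply
    ((measurableSet_gridCell m _).prod (measurableSet_gridCell m _))] at h

variable {Ω : Type*} [MeasurableSpace Ω] {P : Measure Ω} [IsProbabilityMeasure P]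
  {ξ₁ : Ω → Set ℝ} {ξ₂ : Ω → Set (ℝ × ℝ)} {g : ℝ → ℝ} {α : ℝ}

/-- The probabilities that the edges of the grid are open. -/
def gridOpenProb (β : Measure (ℝ × ℝ)) (m K : ℕ) : Fin K ⊕ Fin (K + 1) × Fin (K + 1) → ℝ :=
  Sum.elim (fun _ => Real.exp (-2 * (m : ℝ)⁻¹)) fun e => 1 - Real.exp (-gridCoupling β m e)

/-- Edge states depend only on which of finitely many disjoint cells or rectangles contain points.
These events are independent within each process, and the two processes are independent of each
other. -/
lemma measureReal_openEdges_le (hg : Continuous g) (hξ₁ : IsPoissonProcess ξ₁ cutIntensity P)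
    (hξ₂ : IsPoissonProcess ξ₂ (bondIntensity g α) P)
    (hindep : Indep (configSigma ξ₁) (configSigma ξ₂) P) {m : ℕ} (hm : 0 < m) (M : ℕ)
    (O : Finset (Fin (m * M) ⊕ Fin (m * M + 1) × Fin (m * M + 1))) :
    P.real {ω | openEdges m M (ξ₁ ω) (ξ₂ ω) = O}
      ≤ bernoulliWeight (gridOpenProb (boxIntensity g α M) m (m * M)) O := by
  classical
  let B₁ : Fin (m * M) → Set ℝ := fun i => gridCell m (i + 1)
  let B₂ : Fin (m * M + 1) × Fin (m * M + 1) → Set (ℝ × ℝ) := fun e => gridRect m M e.1 e.2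
  have hB₁ : ∀ i, MeasurableSet (B₁ i) := fun i => measurableSet_gridCell _ _
  have hB₂ : ∀ e, MeasurableSet (B₂ e) := fun e => measurableSet_gridRect _ _ _ _
  have hd₁ : Pairwise fun i j => Disjoint (B₁ i) (B₁ j) := fun i j hij =>
    disjoint_gridCell m fun h => hij (Fin.ext (Nat.succ_injective h))
  have hd₂ : Pairwise fun e f => Disjoint (B₂ e) (B₂ f) := fun e f hef => by
    refine Disjoint.mono Set.inter_subset_left Set.inter_subset_left ?_
    rw [Set.disjoint_prod]
    by_contra! h
    refine hef (Prod.ext (Fin.ext ?_) (Fin.ext ?_))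
    · by_contra hne
      exact h.1 (disjoint_gridCell m hne)
    · by_contra hne
      exact h.2 (disjoint_gridCell m hne)
  have hsub : {ω | openEdges m M (ξ₁ ω) (ξ₂ ω) = O}
      ⊆ emptyPattern ξ₁ B₁ (fun i => Sum.inl i ∈ O) ∩ emptyPattern ξ₂ B₂ (fun e => Sum.inr e ∉ O) := by
    intro ω hω
    have hω' : openEdges m M (ξ₁ ω) (ξ₂ ω) = O := hω
    subst hω'
    refine ⟨fun i => ?_, fun e => ?_⟩ <;> simp [openEdges, countIn, B₁, B₂]
  refine (measureReal_mono hsub).trans_eq ?_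
  rw [Measure.real, (Indep_iff _ _ P).1 hindep _ _ (measurableSet_emptyPattern hB₁ _)
    (measurableSet_emptyPattern hB₂ _), ENNReal.toReal_mul, ← Measure.real, ← Measure.real,
    hξ₁.measure_emptyPattern hB₁ hd₁ (fun i => by
      simp only [B₁, cutIntensity_gridCell hm]; exact ENNReal.ofReal_ne_top),
    hξ₂.measure_emptyPattern hB₂ hd₂ (fun e => bondIntensity_gridRect_ne_top hg _ _ _ _ _),
    bernoulliWeight, Fintype.prod_sum_type]
  have hm' : (0 : ℝ) ≤ 2 * (m : ℝ)⁻¹ := by positivity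
  congr 1
  · refine Finset.prod_congr rfl fun i _ => ?_
    simp only [gridOpenProb, Sum.elim_inl, B₁, Measure.real, cutIntensity_gridCell hm,
      ENNReal.toReal_ofReal hm', neg_mul]
  · refine Finset.prod_congr rfl fun e _ => ?_
    simp only [gridOpenProb, Sum.elim_inr, B₂, bondIntensity_gridRect]
    split_ifs <;> simp_all

/-- The cut intensity 2 is what makes neighbour edges give equality; for a long edge with x = e^J
the difference of the two sides is (x - 1)²/x. -/
lemma gridOpenProb_le {β : Measure (ℝ × ℝ)} {m : ℕ} (hm : 0 < m) (K : ℕ)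
    (e : Fin K ⊕ Fin (K + 1) × Fin (K + 1)) :
    2 * gridOpenProb β m K e ≤ gridEdgeWeight β m K e * (1 - gridOpenProb β m K e) := by
  have hq := exp_neg_grid_lt hm
  rcases e with i | e
  · simp only [gridOpenProb, gridEdgeWeight, Sum.elim_inl]
    rw [div_mul_cancel₀ _ (by linarith)]
  · simp only [gridOpenProb, gridEdgeWeight, Sum.elim_inr, sub_sub_cancel]
    set x := Real.exp (gridCoupling β m e) with hx
    have hpos : 0 < x := Real.exp_pos _
    have h1 : Real.exp (2 * gridCoupling β m e) = x ^ 2 := by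
      rw [hx, ← Real.exp_nat_mul]
      norm_num
    rw [h1, Real.exp_neg, ← hx, ← sub_nonneg]
    have h2 : (x ^ 2 - 1) * x⁻¹ - 2 * (1 - x⁻¹) = (x - 1) ^ 2 * x⁻¹ := by
      field_simp
      ring
    rw [h2]
    positivity

lemma measureReal_linked_le (hg : Continuous g) (hξ₁ : IsPoissonProcess ξ₁ cutIntensity P)
    (hξ₂ : IsPoissonProcess ξ₂ (bondIntensity g α) P)
    (hindep : Indep (configSigma ξ₁) (configSigma ξ₂) P) {m : ℕ} (hm : 0 < m) (M : ℕ)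
    (k : Fin (m * M + 1)) :
    P.real {ω | Linked (gridEnds (m * M)) (openEdges m M (ξ₁ ω) (ξ₂ ω)) 0 k}
      ≤ gridCorr (boxIntensity g α M) m (m * M) k := by
  have hfin := isFiniteMeasure_boxIntensity hg α M
  have hp : ∀ e, 0 ≤ gridOpenProb (boxIntensity g α M) m (m * M) e := by
    rintro (i | e)
    · exact (Real.exp_pos _).le
    · have : 0 ≤ gridCoupling (boxIntensity g α M) m e := measureReal_nonneg
      simpa [gridOpenProb] using this
  have hp1 : ∀ e, gridOpenProb (boxIntensity g α M) m (m * M) e ≤ 1 := by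
    rintro (i | e)
    · exact (exp_neg_grid_lt hm).le
    · simpa [gridOpenProb] using (Real.exp_pos _).le
  refine le_trans ?_ (percolation_le_ising_correlation (gridEnds (m * M))
    (gridEdgeWeight_nonneg hm (m * M)) hp hp1 (gridOpenProb_le hm (m * M)) 0 k)
  have hsub : {ω | Linked (gridEnds (m * M)) (openEdges m M (ξ₁ ω) (ξ₂ ω)) 0 k}
      ⊆ ⋃ O ∈ Finset.univ.filter (fun O => Linked (gridEnds (m * M)) O 0 k),
        {ω | openEdges m M (ξ₁ ω) (ξ₂ ω) = O} := fun ω hω =>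
    Set.mem_iUnion₂.2 ⟨_, Finset.mem_filter.2 ⟨Finset.mem_univ _, hω⟩, rfl⟩
  refine (measureReal_mono hsub (measure_ne_top _ _)).trans
    ((measureReal_biUnion_finset_le _ _).trans ?_)
  rw [Finset.sum_filter]
  refine Finset.sum_le_sum fun O _ => ?_
  split_ifs
  · rw [one_mul]
    exact measureReal_openEdges_le hg hξ₁ hξ₂ hindep hm M O
  · rw [zero_mul]

lemma measureReal_connected_le (hg : Continuous g) (hg_even : ∀ t, g (-t) = g t)
    (hg_nonneg : ∀ t, 0 ≤ g t) (hα : 0 ≤ α) (hξ₁ : IsPoissonProcess ξ₁ cutIntensity P)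
    (hξ₂ : IsPoissonProcess ξ₂ (bondIntensity g α) P)
    (hindep : Indep (configSigma ξ₁) (configSigma ξ₂) P) (n : ℕ) :
    P.real {ω | Connected (ξ₁ ω) (ξ₂ ω) 0 n} ≤ twoPoint g α n := by
  have hS : ∀ᵐ ω ∂P, ∀ N : ℕ, (ξ₁ ω ∩ Set.Icc 0 (N : ℝ)).Finite := by
    rw [ae_all_iff]
    intro N
    filter_upwards [hξ₁.ae_countIn_ne_top measurableSet_Icc (cutIntensity_Icc_ne_top N)] with ω hω
    exact Set.encard_ne_top_iff.1 hω
  let D : ℕ → ℕ → Set Ω := fun M m =>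
    {ω | Linked (gridEnds (m * M)) (openEdges m M (ξ₁ ω) (ξ₂ ω)) (gridNode m M 0)
      (gridNode m M n)}
  -- The Fatou bound is used twice: outside for boxes M → ∞ against the constant `twoPoint g α n`,
  -- and inside for m → ∞ with `M` fixed, where the grid bound tends to the finite-volume two-point
  -- function.
  refine measureReal_le_of_eventually_mem (D := fun M => {ω | ∀ᶠ m in atTop, ω ∈ D M m})
    tendsto_const_nhds ?_ ?_
  · filter_upwards [eventually_ge_atTop n] with M hM
    refine (measureReal_le_of_eventually_mem (D := D M)
      (tendsto_gridCorr hg hg_even hg_nonneg hα hM le_rfl) ?_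
      (Eventually.of_forall fun ω hω => hω)).trans
      (twoPointT_le_twoPoint hg hg_even hg_nonneg hα n M)
    filter_upwards [eventually_gt_atTop 0] with m hm
    have h := measureReal_linked_le hg hξ₁ hξ₂ hindep hm M (gridNode m M n)
    have h0 : gridNode m M 0 = 0 := by simp [gridNode]
    have hn : gridNode m M n = Fin.ofNat (m * M + 1) (m * n) := by
      rw [gridNode, ← Nat.cast_mul, Nat.ceil_natCast]
    simp only [D, h0]
    rwa [hn] at h ⊢
  · filter_upwards [hS] with ω hω hconn
    exact Connected.gridLinked hω le_rfl (Nat.cast_nonneg n) hconn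

end Comparison

end ContinuumIsing

end

theorem mainTheorem9 (g : ℝ → ℝ) (hg_cont : Continuous g) (hg_even : ∀ t, g (-t) = g t)
    (hg_nonneg : ∀ t, 0 ≤ g t) (α : ℝ) (hα : 0 ≤ α)
    {Ω : Type*} [MeasurableSpace Ω] (P : Measure Ω) [IsProbabilityMeasure P]
    (ξ₁ : Ω → Set ℝ) (ξ₂ : Ω → Set (ℝ × ℝ))
    (hξ₁ : ContinuumIsing.IsPoissonProcess ξ₁ ContinuumIsing.cutIntensity P)
    (hξ₂ : ContinuumIsing.IsPoissonProcess ξ₂ (ContinuumIsing.bondIntensity g α) P)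
    (hindep : Indep (ContinuumIsing.configSigma ξ₁) (ContinuumIsing.configSigma ξ₂) P)
    (n : ℕ) :
    Tendsto (fun T : ℝ => ContinuumIsing.twoPointT g α T n) atTop
        (𝓝 (ContinuumIsing.twoPoint g α n)) ∧
      P.real {ω | ContinuumIsing.Connected (ξ₁ ω) (ξ₂ ω) 0 n} ≤ ContinuumIsing.twoPoint g α n :=
  ⟨ContinuumIsing.tendsto_twoPointT hg_cont hg_even hg_nonneg hα n,
    ContinuumIsing.measureReal_connected_le hg_cont hg_even hg_nonneg hα hξ₁ hξ₂ hindep n⟩
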